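/- **Protocol VBCT2 (variable bias coin tossing between mistrustful parties Alice, with separated agents $A_1,A_2$, and Bob, with separated agents $B_1,B_2$).** Let $\alpha_i,\beta_i>0$ be real with $\alpha_i^2+\beta_i^2=1$ ($i=0,1$), $\alpha_1^2<\alpha_0^2$, and put $|\psi_i\rangle=\alpha_i|00\rangle+\beta_i|11\rangle$, $p_{\min}=\alpha_1^2$, $p_{\max}=\alpha_0^2$, $\rho_i=\mathrm{tr}_B|\psi_i\rangle\langle\psi_i|$. Bob has an input bit $w$. In each round $B_1$ creates $N\ge 2$ states, each independently and uniformly $|\psi_0\rangle$ or $|\psi_1\rangle$ (a batch of $N$ equal states is rejected and redrawn), and sends the second qubits to $A_1$; $B_2$ knows which states were chosen. Alice picks $z=0$ (trust) with probability $2^{-M}$ and $z=1$ (test) otherwise; $A_1,A_2$ simultaneously tell $z$ to $B_1,B_2$, and $A_2$'s message is spacelike separated from the creation of the batch. If $z=1$, $B_1$ sends his qubits and the list of identities to $A_1$ and $B_2$ sends the list to $A_2$; Alice aborts (Bob is caught) unless the lists agree and the projective measurements onto the claimed states succeed, in which case a new round starts. If $z=0$, $B_1$ chooses uniformly a position $i$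 among the states $|\psi_w\rangle$ of the batch, $B_1$ and $B_2$ announce $i$ (the announcements must agree), and $A_1$ and $B_1$ measure their halves of state $i$ in the computational basis, which gives the outcome of the coin toss. Bob aborts (Alice is detected) if the bits $z$ received by $B_1$ and $B_2$ differ. Let $p_c$ be the probability that the protocol is completed with outcome $c$. A dishonest party may use any (finite-dimensional) quantum strategy, with memories, prior entanglement, and joint operations of its two agents except where the timing of the protocol forces them to act locally. Let $\tilde\sigma_w$ be the sum of $\rho_{i_1}\otimes\cdots\otimes\rho_{i_{N-1}}$ over all strings $i\in\{0,1\}^{N-1}$ other than the constant string $w\cdots w$, $\sigma_w=\tilde\sigma_w/\mathrm{tr}\,\tilde\sigma_w$, and $D(\rho,\sigma)=\frac12\mathrm{tr}|\rho-\sigma|$. Then: 1. *Any range of biases.* Every pair $0<p_{\min}<p_{\max}<1$ arises from such amplitudes. If both parties are honest, the protocol never aborts, both get the same outcome, and $p_0=p_{\max}$ if $w=0$, $p_0=p_{\min}$ if $w=1$. 2. *Discrimination.* As $N\to\infty$, $D(\sigma_0,\sigma_1)\to0$ and $D(\rho_0\otimes\sigma_0,\rho_1\otimes\sigma_1)\to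 D(\rho_0,\rho_1)$. For every prior distribution on $w$, the maximal probability of identifying $w$ from $\rho_w\otimes\sigma_w$ tends to the maximal probability of identifying $w$ from $\rho_w$, and the latter is attained by the measurement in the computational basis. 3. *Security against Alice.* If Bob is honest then, for every strategy of Alice and every $w$, $p_0\le\alpha_w^2$ and $p_1\le\beta_w^2$. There is $\varepsilon(N)\to0$ such that, for all amplitudes, every prior distribution of $w$ and every strategy of Alice, the information on $w$ (in bits, conditional on the outcome of the coin toss, counted over the runs in which Bob does not detect cheating) that Alice obtains is at most $\varepsilon(N)$. 4. *Security against Bob.* Let Alice be honest, let $c\in\{0,1\}$, and put $p^{*}_0=p_{\max}$, $p^{*}_1=1-p_{\min}$. For all $\delta,\delta',\kappa>0$ there is $M_0$ such that, for all $M\ge M_0$, all amplitudes, all $N$ and all strategies of Bob: if, given that the coin toss stage ($z=0$) is reached without Bob having been caught, $B_2$ identifies with probability at least $\delta'$ a position $i$ for which the state of $A_1$'s $i$-th qubit (given $B_2$'s data) satisfies $\langle c|\rho_i|c\rangle\ge p^{*}_c+\delta$, then Bob is caught with probability at least $1-\kappa$. (If that stage is reached with probability $0$, the condition counts as satisfied.)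 Moreover there is $\varepsilon(M)\to0$ such that, for all amplitudes, $N$, $M$ and strategies of Bob, there is $p\in[p_{\min},p_{\max}]$ with $p_0\le p+\varepsilon(M)$ and $p_1\le 1-p+\varepsilon(M)$. -/

import Mathlib

open scoped Matrix Kronecker MatrixOrder ComplexOrder

noncomputable section

namespace VBCT2

/-! ### Finite-dimensional quantum mechanics

A system is given by a finite type `m` indexing an orthonormal basis of its Hilbert space, and
states and operators are complex matrices indexed by `m`. Composite systems have product index. -/

/-- Computational basis of `n` qubits. -/
abbrev Qubits (n : ℕ) : Type := Fin n → Fin 2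

/-- A density operator. -/
def IsDensity {m : Type} [Fintype m] (ρ : Matrix m m ℂ) : Prop :=
  ρ.PosSemidef ∧ ρ.trace = 1

/-- A quantum instrument in Kraus form: a general local operation on the system `m`, with
classical outcome in `X` and output system `n`. If `X = Unit`, this is a quantum channel. -/
structure Instrument (X m n : Type) [Fintype X] [Fintype m] [DecidableEq m] [Fintype n] where
  r : ℕ
  K : X → Fin r → Matrix n m ℂ
  complete : ∑ x, ∑ j, (K x j)ᴴ * K x j = 1

/-- A positive operator valued measure with outcomes in `X`. -/
structure POVM (X m : Type) [Fintype X] [Fintype m] [DecidableEq m] where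
  E : X → Matrix m m ℂ
  pos : ∀ x, (E x).PosSemidef
  total : ∑ x, E x = 1

/-- Unnormalized state after a channel. -/
def Instrument.channel {m n : Type} [Fintype m] [DecidableEq m] [Fintype n]
    (I : Instrument Unit m n) (ρ : Matrix m m ℂ) : Matrix n n ℂ :=
  ∑ j, I.K () j * ρ * (I.K () j)ᴴ

/-- Probability weight `tr (E ω)` of the effect `E` in the (unnormalized) state `ω`. -/
def born {m : Type} [Fintype m] (E ω : Matrix m m ℂ) : ℝ := (E * ω).trace.re

/-- The projector onto `|c⟩` for the `i`-th of `N` qubits. -/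
def proj {N : ℕ} (i : Fin N) (c : Fin 2) : Matrix (Qubits N) (Qubits N) ℂ :=
  Matrix.diagonal fun x => if x i = c then 1 else 0

/-- The trace distance `½ tr |ρ - σ|`. -/
def traceDist {m : Type} [Fintype m] [DecidableEq m] (ρ σ : Matrix m m ℂ) : ℝ :=
  (1 / 2) * (CFC.abs (ρ - σ)).trace.re

/-- The prior distribution giving `0` the probability `η` and `1` the probability `1 - η`. -/
def prior (η : ℝ) (w : Fin 2) : ℝ := if w = 0 then η else 1 - η

/-- The probabilities with which a measurement can identify a state that is `ρ 0` with
probability `η` and `ρ 1` with probability `1 - η`. -/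
def successProbs {m : Type} [Fintype m] [DecidableEq m] (η : ℝ) (ρ : Fin 2 → Matrix m m ℂ) :
    Set ℝ :=
  {s | ∃ G : POVM (Fin 2) m, s = ∑ w, prior η w * born (G.E w) (ρ w)}

/-! ### The states used by the protocol -/

/-- The agreed amplitudes of `|ψ_i⟩ = α_i |00⟩ + β_i |11⟩`. -/
structure Params where
  α : Fin 2 → ℝ
  β : Fin 2 → ℝ
  α_pos : ∀ i, 0 < α i
  β_pos : ∀ i, 0 < β i
  unit : ∀ i, α i ^ 2 + β i ^ 2 = 1
  lt : α 1 ^ 2 < α 0 ^ 2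

namespace Params

variable (P : Params)

def pmin : ℝ := P.α 1 ^ 2

def pmax : ℝ := P.α 0 ^ 2

/-- The probability of the outcome `c` when the state `|ψ_w⟩` is used for the coin toss. -/
def prob (w c : Fin 2) : ℝ := if c = 0 then P.α w ^ 2 else P.β w ^ 2

/-- The largest legitimate probability of the outcome `c`. -/
def top (c : Fin 2) : ℝ := if c = 0 then P.pmax else 1 - P.pmin

/-- Amplitudes of `|ψ_i⟩`. The first qubit is the one `B₁` keeps, the second is sent to `A₁`. -/
def psi (i : Fin 2) (s : Fin 2 × Fin 2) : ℂ :=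
  if s.1 = s.2 then (if s.1 = 0 then (P.α i : ℂ) else (P.β i : ℂ)) else 0

/-- Amplitudes of the batch `⊗_j |ψ_{b_j}⟩`. The first string refers to the `N` qubits that `B₁`
keeps, the second to those sent to `A₁`. -/
def batch {N : ℕ} (b : Qubits N) (s : Qubits N × Qubits N) : ℂ :=
  ∏ j, P.psi (b j) (s.1 j, s.2 j)

/-- `ρ_i = tr_B |ψ_i⟩⟨ψ_i|`. -/
def rho (i : Fin 2) : Matrix (Fin 2) (Fin 2) ℂ :=
  Matrix.of fun x x' => ∑ y, P.psi i (y, x) * star (P.psi i (y, x'))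

/-- The sum of `ρ_{i_1} ⊗ ⋯ ⊗ ρ_{i_n}` over all strings `i` which, together with one further
symbol `w`, do not make a constant string. -/
def sigmaTilde (w : Fin 2) (n : ℕ) : Matrix (Qubits n) (Qubits n) ℂ :=
  ∑ b ∈ Finset.univ.filter (fun b : Qubits n => ∃ j, b j ≠ w),
    Matrix.of fun x x' => ∏ j, P.rho (b j) (x j) (x' j)

/-- Normalization of `sigmaTilde`. -/
def sigma (w : Fin 2) (n : ℕ) : Matrix (Qubits n) (Qubits n) ℂ :=
  (P.sigmaTilde w n).trace⁻¹ • P.sigmaTilde w n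

/-- `ρ_w ⊗ σ_w` for a batch of `N` states: the chosen qubit and the other `N - 1` qubits. -/
def rhoSigma (N : ℕ) (w : Fin 2) :
    Matrix (Fin 2 × Qubits (N - 1)) (Fin 2 × Qubits (N - 1)) ℂ :=
  P.rho w ⊗ₖ P.sigma w (N - 1)

end Params

/-- The batches that an honest Bob does not reject: those in which both states occur. He uses
each of them with the same probability. -/
def goodBatches (N : ℕ) : Finset (Qubits N) :=
  Finset.univ.filter fun b => ∃ i j, b i ≠ b j

/-- The positions in the batch `b` of the states with the bias that the input `w` asks for. An
honest Bob picks one of them uniformly at random. -/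
def candidates {N : ℕ} (b : Qubits N) (w : Fin 2) : Finset (Fin N) :=
  Finset.univ.filter fun i => b i = w

/-- The probability `2^{-M}` with which an honest Alice trusts Bob (`z = 0`) on a given batch. -/
def trust (M : ℕ) : ℝ := (2 : ℝ)⁻¹ ^ M

/-! ### Both parties honest -/

/-- The probability that Alice's projective test accepts an honest batch. -/
def honestPass (P : Params) {N : ℕ} (b : Qubits N) : ℝ :=
  ‖∑ s, star (P.batch b s) * P.batch b s‖ ^ 2

/-- The probability that measuring both qubits of the `i`-th state of an honest batch gives `cA`
for Alice and `cB` for Bob. -/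
def honestToss (P : Params) {N : ℕ} (b : Qubits N) (i : Fin N) (cA cB : Fin 2) : ℝ :=
  ∑ s ∈ Finset.univ.filter (fun s : Qubits N × Qubits N => s.1 i = cB ∧ s.2 i = cA),
    ‖P.batch b s‖ ^ 2

/-- The probability that, with both parties honest and Bob's input `w`, the protocol is completed
and Alice's output is `cA` and Bob's output is `cB`. -/
def honestOut (P : Params) (N M : ℕ) (w cA cB : Fin 2) : ℝ :=
  ∑' k : ℕ, trust M * (1 - trust M) ^ k *
    (((goodBatches N).card : ℝ)⁻¹ * ∑ b ∈ goodBatches N, honestPass P b) ^ k *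
    (((goodBatches N).card : ℝ)⁻¹ * ∑ b ∈ goodBatches N,
      ((candidates b w).card : ℝ)⁻¹ * ∑ i ∈ candidates b w, honestToss P b i cA cB)

/-! ### Honest Alice, arbitrary Bob -/

/-- A strategy of a dishonest Bob, for batches of size `N`. At the start of round `k` his agents
`B₁` and `B₂` hold memories of dimensions `m₁ k` and `m₂ k` in an arbitrary joint state. They may
interact to prepare the round (`prep`): this creates the `N` qubits sent to `A₁` and leaves `B₁`
and `B₂` with systems of dimensions `d₁ k` and `d₂ k`. From the moment Alice announces `z` until
they have replied, `B₁` and `B₂` act locally.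

If `z = 1`, then `B₁` sends `N` qubits and a claimed identity string to `A₁` (`test₁`) and `B₂`
sends a claimed identity string to `A₂` (`test₂`); both keep a memory. If `z = 0`, then `B₁`
announces a position (`coin₁`), and `B₂` announces a position, and may obtain further
private data (`coin₂`). -/
structure BobStrategy (N : ℕ) where
  m₁ : ℕ → ℕ
  m₂ : ℕ → ℕ
  d₁ : ℕ → ℕ
  d₂ : ℕ → ℕ
  R : ℕ → ℕ
  start : Matrix (Fin (m₁ 0) × Fin (m₂ 0)) (Fin (m₁ 0) × Fin (m₂ 0)) ℂ
  start_density : IsDensity start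
  prep : ∀ k, Instrument Unit (Fin (m₁ k) × Fin (m₂ k)) (Qubits N × (Fin (d₁ k) × Fin (d₂ k)))
  test₁ : ∀ k, Instrument (Qubits N) (Fin (d₁ k)) (Qubits N × Fin (m₁ (k + 1)))
  test₂ : ∀ k, Instrument (Qubits N) (Fin (d₂ k)) (Fin (m₂ (k + 1)))
  coin₁ : ∀ k, POVM (Fin N) (Fin (d₁ k))
  coin₂ : ∀ k, POVM (Fin N × Fin (R k)) (Fin (d₂ k))

/-- The partial bra `⟨Ψ_b|` of the batch `b`, applied to the `N` qubits that `A₁` has and the `N`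
qubits that `B₁` returns, and the identity on the memories of `B₁` and `B₂`. -/
def batchBra (P : Params) {N m₁ m₂ : ℕ} (b : Qubits N) :
    Matrix (Fin m₁ × Fin m₂) (Qubits N × ((Qubits N × Fin m₁) × Fin m₂)) ℂ :=
  Matrix.of fun a s => if a = (s.2.1.2, s.2.2) then star (P.batch b (s.2.1.1, s.1)) else 0

namespace BobStrategy

variable {N : ℕ} (S : BobStrategy N) (P : Params)

/-- The Kraus operator, in round `k`, of the event that the batch is tested and passes: `B₁` and
`B₂` send the same identity string `b`, and the `N` qubit pairs are projected onto the claimed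
batch `⊗_j |ψ_{b_j}⟩`. -/
def passKraus (k : ℕ) (b : Qubits N) (j : Fin (S.test₁ k).r) (l : Fin (S.test₂ k).r) :
    Matrix (Fin (S.m₁ (k + 1)) × Fin (S.m₂ (k + 1)))
      (Qubits N × (Fin (S.d₁ k) × Fin (S.d₂ k))) ℂ :=
  batchBra P b * ((1 : Matrix (Qubits N) (Qubits N) ℂ) ⊗ₖ
    ((S.test₁ k).K b j ⊗ₖ (S.test₂ k).K b l))

/-- From the state of a round to the (unnormalized) state of Bob's memories, conditional on the
batch being tested and passing. -/
def passTest (k : ℕ)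
    (ω : Matrix (Qubits N × (Fin (S.d₁ k) × Fin (S.d₂ k)))
      (Qubits N × (Fin (S.d₁ k) × Fin (S.d₂ k))) ℂ) :
    Matrix (Fin (S.m₁ (k + 1)) × Fin (S.m₂ (k + 1)))
      (Fin (S.m₁ (k + 1)) × Fin (S.m₂ (k + 1))) ℂ :=
  ∑ b : Qubits N, ∑ j, ∑ l, S.passKraus P k b j l * ω * (S.passKraus P k b j l)ᴴ

/-- The state of Bob's memories at the start of round `k`, if Alice has tested all earlier
batches. Its trace is the probability that they have all passed. -/
def memory : ∀ k, Matrix (Fin (S.m₁ k) × Fin (S.m₂ k)) (Fin (S.m₁ k) × Fin (S.m₂ k)) ℂ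
  | 0 => S.start
  | k + 1 => S.passTest P k ((S.prep k).channel (memory k))

/-- The joint (unnormalized) state in round `k` of `A₁`'s `N` qubits and the systems of `B₁` and
`B₂`, when Alice announces `z`. -/
def state (k : ℕ) : Matrix (Qubits N × (Fin (S.d₁ k) × Fin (S.d₂ k)))
    (Qubits N × (Fin (S.d₁ k) × Fin (S.d₂ k))) ℂ :=
  (S.prep k).channel (S.memory P k)

/-- The probability that the first `k` batches all pass, if they are all tested. -/
def survive (k : ℕ) : ℝ := (S.memory P k).trace.re

/-- The probability that Alice catches Bob: some tested batch fails her test. -/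
def caughtProb (M : ℕ) : ℝ :=
  ∑' k, (1 - trust M) ^ (k + 1) * (S.survive P k - S.survive P (k + 1))

/-- The probability that the coin toss stage (`z = 0`) is reached, without Bob being caught. -/
def tossProb (M : ℕ) : ℝ := ∑' k, trust M * (1 - trust M) ^ k * S.survive P k

/-- The weight in round `k` of the result `t = (i, r)` for `B₂`, who thus announces `i`. -/
def announceWeight (k : ℕ) (t : Fin N × Fin (S.R k)) : ℝ :=
  born ((1 : Matrix (Qubits N) (Qubits N) ℂ) ⊗ₖ
    ((1 : Matrix (Fin (S.d₁ k)) (Fin (S.d₁ k)) ℂ) ⊗ₖ (S.coin₂ k).E t)) (S.state P k)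

/-- The weight in round `k` of the result `t = (i, r)` for `B₂` and `c` for a measurement of
`A₁`'s `i`-th qubit. Divided by `announceWeight`, this is `⟨c|ρ_i|c⟩`, where `ρ_i` is the state of
that qubit given what `B₂` knows. -/
def announceTossWeight (k : ℕ) (t : Fin N × Fin (S.R k)) (c : Fin 2) : ℝ :=
  born (proj t.1 c ⊗ₖ
    ((1 : Matrix (Fin (S.d₁ k)) (Fin (S.d₁ k)) ℂ) ⊗ₖ (S.coin₂ k).E t)) (S.state P k)

/-- The probability that the coin toss stage is reached, and `B₂` then identifies a position `i`
such that the state `ρ_i` of `A₁`'s `i`-th qubit gives the outcome `c` with probability exceeding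
the largest legitimate one by at least `δ`. -/
def cheatProb (M : ℕ) (c : Fin 2) (δ : ℝ) : ℝ :=
  ∑' k, trust M * (1 - trust M) ^ k * ∑ t,
    if (P.top c + δ) * S.announceWeight P k t ≤ S.announceTossWeight P k t c
    then S.announceWeight P k t else 0

/-- The probability that the protocol is completed with output `c` for Alice: the coin toss stage
is reached, `B₁` and `B₂` announce the same position, and `A₁`'s measurement gives `c`. -/
def outProb (M : ℕ) (c : Fin 2) : ℝ :=
  ∑' k, trust M * (1 - trust M) ^ k * ∑ i : Fin N, ∑ r : Fin (S.R k),
    born (proj i c ⊗ₖ ((S.coin₁ k).E i ⊗ₖ (S.coin₂ k).E (i, r))) (S.state P k)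

end BobStrategy

/-! ### Honest Bob, arbitrary Alice -/

/-- A strategy of a dishonest Alice, for batches of size `N`. At the start of round `k` her agents
`A₁` and `A₂` hold memories of dimensions `m₁ k` and `m₂ k` in an arbitrary joint state. `A₁`
chooses her bit `z₁` by an operation on her memory and the batch just received (`bit₁`), and `A₂`
her bit `z₂` by an operation on her memory alone (`bit₂`), as her announcement is spacelike
separated from the creation of the batch.

If `z₁ = z₂ = 1`, Alice receives Bob's qubits and the identity string `b`, and prepares for the
next round by any joint operation (`next`). If `z₁ = z₂ = 0`, she learns the chosen position `i`
and performs any joint measurement (`final`) on all that she has. If `z₁ ≠ z₂`, then Bob knows for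
certain that she is cheating as soon as `B₁` and `B₂` compare these bits, and he aborts. -/
structure AliceStrategy (N : ℕ) where
  m₁ : ℕ → ℕ
  m₂ : ℕ → ℕ
  n₁ : ℕ → ℕ
  n₂ : ℕ → ℕ
  R : ℕ → ℕ
  start : Matrix (Fin (m₁ 0) × Fin (m₂ 0)) (Fin (m₁ 0) × Fin (m₂ 0)) ℂ
  start_density : IsDensity start
  bit₁ : ∀ k, Instrument (Fin 2) (Fin (m₁ k) × Qubits N) (Fin (n₁ k))
  bit₂ : ∀ k, Instrument (Fin 2) (Fin (m₂ k)) (Fin (n₂ k))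
  next : ∀ k, Qubits N → Instrument Unit ((Fin (n₁ k) × Fin (n₂ k)) × Qubits N)
    (Fin (m₁ (k + 1)) × Fin (m₂ (k + 1)))
  final : ∀ k, Fin N → POVM (Fin (R k)) (Fin (n₁ k) × Fin (n₂ k))

/-- The joint state `τ ⊗ |Ψ_b⟩⟨Ψ_b|`: the memory and the batch qubits of `A₁`, the memory of `A₂`,
and the qubits of `B₁`. -/
def withBatch (P : Params) {N m₁ m₂ : ℕ} (b : Qubits N)
    (τ : Matrix (Fin m₁ × Fin m₂) (Fin m₁ × Fin m₂) ℂ) :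
    Matrix (((Fin m₁ × Qubits N) × Fin m₂) × Qubits N)
      (((Fin m₁ × Qubits N) × Fin m₂) × Qubits N) ℂ :=
  Matrix.of fun s s' => τ (s.1.1.1, s.1.2) (s'.1.1.1, s'.1.2) *
    (P.batch b (s.2, s.1.1.2) * star (P.batch b (s'.2, s'.1.1.2)))

/-- For nonnegative weights `a` and `b` of two alternatives: their total weight times the Shannon
entropy, in bits, of the normalized distribution. -/
def weightedEntropy (a b : ℝ) : ℝ :=
  -(a * Real.logb 2 (a / (a + b))) - b * Real.logb 2 (b / (a + b))

namespace AliceStrategy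

variable {N : ℕ} (S : AliceStrategy N) (P : Params)

/-- The (unnormalized) joint state, in round `k` on the batch `b`, after `A₁` and `A₂` have both
announced the bit `z`. -/
def afterBits (k : ℕ) (b : Qubits N) (z : Fin 2)
    (τ : Matrix (Fin (S.m₁ k) × Fin (S.m₂ k)) (Fin (S.m₁ k) × Fin (S.m₂ k)) ℂ) :
    Matrix ((Fin (S.n₁ k) × Fin (S.n₂ k)) × Qubits N)
      ((Fin (S.n₁ k) × Fin (S.n₂ k)) × Qubits N) ℂ :=
  ∑ j, ∑ l,
    (((S.bit₁ k).K z j ⊗ₖ (S.bit₂ k).K z l) ⊗ₖ (1 : Matrix (Qubits N) (Qubits N) ℂ)) *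
      withBatch P b τ *
    (((S.bit₁ k).K z j ⊗ₖ (S.bit₂ k).K z l) ⊗ₖ (1 : Matrix (Qubits N) (Qubits N) ℂ))ᴴ

/-- The (unnormalized) state of Alice's memories at the start of round `k`; its trace is the
probability that this round takes place. -/
def memory : ∀ k, Matrix (Fin (S.m₁ k) × Fin (S.m₂ k)) (Fin (S.m₁ k) × Fin (S.m₂ k)) ℂ
  | 0 => S.start
  | k + 1 => ((goodBatches N).card : ℂ)⁻¹ • ∑ b ∈ goodBatches N,
      (S.next k b).channel (S.afterBits P k b 1 (memory k))

/-- The probability, given Bob's input `w`, that the coin is tossed in round `k` without Bob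
detecting any cheating, that its outcome (found by `B₁` on the chosen qubit) is `c`, and that
Alice's final measurement gives `y`. -/
def viewProb (w : Fin 2) (k : ℕ) (c : Fin 2) (y : Fin (S.R k)) : ℝ :=
  ((goodBatches N).card : ℝ)⁻¹ * ∑ b ∈ goodBatches N,
    ((candidates b w).card : ℝ)⁻¹ * ∑ i ∈ candidates b w,
      born ((S.final k i).E y ⊗ₖ proj i c) (S.afterBits P k b 0 (S.memory P k))

/-- The probability, given Bob's input `w`, that the protocol is completed without Bob detecting
any cheating, with output `c` for Bob. -/
def outProb (w c : Fin 2) : ℝ := ∑' k, ∑ y, S.viewProb P w k c y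

/-- `H(W | C) - H(W | C, Y)`: the number of bits of information on Bob's input `W`, beyond what is
implied by the outcome `C` of the coin toss, that Alice's view `Y` gives her in the runs in which
Bob does not detect any cheating. The input is `0` with probability `η`. -/
def excessInfo (η : ℝ) : ℝ :=
  ∑ c, weightedEntropy (η * S.outProb P 0 c) ((1 - η) * S.outProb P 1 c) -
    ∑' k, ∑ c, ∑ y,
      weightedEntropy (η * S.viewProb P 0 k c y) ((1 - η) * S.viewProb P 1 k c y)

end AliceStrategy

end VBCT2

end

/-!
All seven claims reduce to finite-dimensional linear algebra and to sums over the rounds.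

*Discrimination.* Since `ρ_0` and `ρ_1` are diagonal, so are `σ_0` and `σ_1`, and the trace distance
and the optimal success probability are sums over the computational basis. The distributions of
`σ_0` and `σ_1` differ only in which constant string is left out, a change of order `2^{-N}`
(`Params.sum_abs_sigmaDist_sub_le`), and both sums depend continuously on the distributions
(`abs_sum_homogeneous_sub_le`).

*Bob.* Consider one round, and let `B₁` perform his reply to a test also if the coin is tossed;
`A₁` and `B₂` cannot notice this. If the test were passed with certainty then, given the reply `b`,
the qubits of `A₁` together with those returned would be in the pure state `|Ψ_b⟩`, hence
independent of the system of `B₂`, and no measurement of `B₂` could reveal a position with an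
illegitimate bias. `born_le_of_coisometry` is the quantitative form of this: the weight of an
outcome exceeds `1 + ε` times the legitimate one by at most `1 + 1/ε` times the probability that the
projection fails. This is at most the decrement of the survival probability, so the failure
probabilities add up to at most `1` over all rounds; and Alice trusts Bob in the `k`-th round with
probability at most `2^{-M}`. So all that Bob can gain is of order `2^{-M} / ε`
(`BobStrategy.tsum_fail_le`). With the identity `caughtProb = 1 - tossProb` this gives the bound for
cheating, and with `ε = 2^{-M/2}` the one for the outcome probabilities.

*Alice.* The bit of `A₂` is independent of the batch. So the probability that a round is played to
its end with outcome `c` is at most `prob w c` times the probability that `A₂` announces `0` in it,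
and the latter probabilities add up to at most `1` (`AliceStrategy.tsum_announce_le`). Once `B₁` has
found the outcome `c`, the state of the chosen pair is `|cc⟩`, whichever state it was before
(`born_proj_withBatch_update`). So, given the outcome, Alice's view depends on Bob's input only
through the joint distribution of the position and of the other states of the batch, which differs
by `O(N^{-1/2})` for the two inputs (`sum_weight_deviation_le`). The part of the view that is common
to both inputs carries no information, and continuity of the entropy (`weightedEntropy_add_le`)
bounds the effect of the rest.
-/

namespace VBCT2

/-! ### Amplitudes and product distributions -/

namespace Params

variable (P : Params)

/-- The amplitude of `|cc⟩` in `|ψ_i⟩`. -/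
def amp (i c : Fin 2) : ℝ := if c = 0 then P.α i else P.β i

/-- The probability of the string `x` when all states of the batch `b` are measured in the
computational basis. -/
def batchProb {N : ℕ} (b x : Qubits N) : ℝ := ∏ j, P.prob (b j) (x j)

lemma amp_pos (i c : Fin 2) : 0 < P.amp i c := by
  unfold amp; split_ifs
  exacts [P.α_pos i, P.β_pos i]

lemma amp_sq (i c : Fin 2) : P.amp i c ^ 2 = P.prob i c := by
  unfold amp prob; split_ifs <;> rfl

lemma prob_pos (i c : Fin 2) : 0 < P.prob i c := by
  rw [← amp_sq]; exact pow_pos (P.amp_pos i c) 2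

lemma sum_prob (i : Fin 2) : ∑ c, P.prob i c = 1 := by
  rw [Fin.sum_univ_two, ← P.unit i]; simp [prob]

lemma prob_le_one (i c : Fin 2) : P.prob i c ≤ 1 := by
  rw [← P.sum_prob i]
  exact Finset.single_le_sum (fun c _ => (P.prob_pos i c).le) (Finset.mem_univ c)

lemma prob_zero_mem (i : Fin 2) : P.prob i 0 ∈ Set.Icc P.pmin P.pmax := by
  have h := P.lt
  fin_cases i <;> simp [prob, pmin, pmax, h.le]

lemma prob_le_top (i c : Fin 2) : P.prob i c ≤ P.top c := by
  have h := P.sum_prob i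
  have h' := P.prob_zero_mem i
  rw [Fin.sum_univ_two] at h
  fin_cases c
  · simpa [top] using h'.2
  · have := h'.1
    simp only [top, Fin.mk_one, one_ne_zero, if_false]
    linarith

lemma top_nonneg (c : Fin 2) : 0 ≤ P.top c :=
  (P.prob_pos 0 c).le.trans (P.prob_le_top 0 c)

lemma top_le_one (c : Fin 2) : P.top c ≤ 1 := by
  fin_cases c
  · simpa [top, pmax, prob] using P.prob_le_one 0 0
  · have := P.prob_pos 1 0
    simp only [prob, if_true] at this
    simp only [top, pmin, Fin.mk_one, one_ne_zero, if_false]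
    linarith

lemma psi_eq (i x y : Fin 2) : P.psi i (x, y) = if x = y then (P.amp i x : ℂ) else 0 := by
  unfold psi amp
  by_cases h : x = y
  · subst h; split_ifs <;> simp_all
  · simp [h]

lemma batch_eq {N : ℕ} (b x y : Qubits N) :
    P.batch b (x, y) = if x = y then ((∏ j, P.amp (b j) (x j) : ℝ) : ℂ) else 0 := by
  unfold batch
  split_ifs with h
  · subst h; simp [psi_eq]
  · obtain ⟨j, hj⟩ := Function.ne_iff.1 h
    exact Finset.prod_eq_zero (Finset.mem_univ j) (by simp [psi_eq, hj])

lemma star_batch {N : ℕ} (b : Qubits N) (s : Qubits N × Qubits N) :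
    star (P.batch b s) = P.batch b s := by
  rw [show s = (s.1, s.2) from rfl, batch_eq]; split_ifs <;> simp

lemma batch_self_mul {N : ℕ} (b x : Qubits N) :
    P.batch b (x, x) * P.batch b (x, x) = (P.batchProb b x : ℂ) := by
  rw [batch_eq, if_pos rfl, ← Complex.ofReal_mul, ← Finset.prod_mul_distrib]
  simp only [← pow_two, amp_sq, batchProb]

lemma norm_batch_sq {N : ℕ} (b x y : Qubits N) :
    ‖P.batch b (x, y)‖ ^ 2 = if x = y then P.batchProb b x else 0 := by
  rw [batch_eq]
  split_ifs with h
  · rw [Complex.norm_real, Real.norm_eq_abs, sq_abs, ← Finset.prod_pow]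
    simp only [amp_sq, batchProb]
  · simp

lemma batchProb_nonneg {N : ℕ} (b x : Qubits N) : 0 ≤ P.batchProb b x :=
  Finset.prod_nonneg fun _ _ => (P.prob_pos _ _).le

lemma sum_batchProb {N : ℕ} (b : Qubits N) : ∑ x, P.batchProb b x = 1 := by
  unfold batchProb
  rw [← Fintype.piFinset_univ, ← Finset.prod_univ_sum]
  exact Finset.prod_eq_one fun j _ => P.sum_prob (b j)

/-- The marginals of the product distribution. -/
lemma sum_batchProb_apply {N : ℕ} (b : Qubits N) (i : Fin N) (c : Fin 2) :
    ∑ x, (if x i = c then P.batchProb b x else 0) = P.prob (b i) c := by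
  have h : ∀ x : Qubits N, (if x i = c then P.batchProb b x else 0) =
      ∏ j, (if j = i then (if x j = c then P.prob (b j) (x j) else 0) else P.prob (b j) (x j)) := by
    intro x
    split_ifs with hx
    · refine Finset.prod_congr rfl fun j _ => ?_
      by_cases hj : j = i
      · subst hj; simp [hx]
      · simp [hj]
    · exact (Finset.prod_eq_zero (Finset.mem_univ i) (by simp [hx])).symm
  have h2 := Finset.prod_univ_sum (fun _ : Fin N => (Finset.univ : Finset (Fin 2)))
    (fun j y => if j = i then (if y = c then P.prob (b j) y else 0) else P.prob (b j) y)
  rw [Fintype.piFinset_univ] at h2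
  rw [Finset.sum_congr rfl fun x _ => h x, ← h2, Finset.prod_eq_single i]
  · simp
  · intro j _ hj; simpa [hj] using P.sum_prob (b j)
  · simp

end Params

/-! ### The range of biases and the honest protocol -/

lemma exists_params {p q : ℝ} (hp : 0 < p) (hpq : p < q) (hq : q < 1) :
    ∃ P : Params, P.pmin = p ∧ P.pmax = q := by
  have hp1 : 0 < 1 - p := by linarith
  have hq1 : 0 < 1 - q := by linarith
  have hq0 : 0 < q := by linarith
  refine ⟨⟨![√q, √p], ![√(1 - q), √(1 - p)], ?_, ?_, ?_, ?_⟩, ?_, ?_⟩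
  · intro i; fin_cases i <;> simp [hp, hq0]
  · intro i; fin_cases i <;> simp [hpq.trans hq, hq]
  · intro i; fin_cases i <;> simp [Real.sq_sqrt, hp.le, hq0.le, hp1.le, hq1.le]
  · simpa [Real.sq_sqrt, hp.le, hq0.le] using hpq
  · simp [Params.pmin, Real.sq_sqrt, hp.le]
  · simp [Params.pmax, Real.sq_sqrt, hq0.le]

lemma trust_pos (M : ℕ) : 0 < trust M := by unfold trust; positivity

lemma trust_le_one (M : ℕ) : trust M ≤ 1 := pow_le_one₀ (by norm_num) (by norm_num)

lemma hasSum_trust (M : ℕ) : HasSum (fun k => trust M * (1 - trust M) ^ k) 1 := by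
  have h := (hasSum_geometric_of_lt_one (sub_nonneg.2 (trust_le_one M))
    (sub_lt_self 1 (trust_pos M))).mul_left (trust M)
  rwa [sub_sub_cancel, mul_inv_cancel₀ (trust_pos M).ne'] at h

lemma tendsto_trust : Filter.Tendsto trust Filter.atTop (nhds 0) :=
  tendsto_pow_atTop_nhds_zero_of_lt_one (by norm_num) (by norm_num)

lemma goodBatches_card {N : ℕ} (hN : 2 ≤ N) : (goodBatches N).card = 2 ^ N - 2 := by
  have h0 : (⟨0, by omega⟩ : Fin N) ≠ ⟨1, by omega⟩ := by simp
  have h : goodBatches N = (Finset.univ.image (fun w : Fin 2 => (fun _ => w : Qubits N)))ᶜ := by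
    ext b
    simp only [goodBatches, Finset.mem_filter, Finset.mem_univ, true_and, Finset.mem_compl,
      Finset.mem_image, not_exists]
    constructor
    · rintro ⟨i, j, hij⟩ w rfl; exact hij rfl
    · intro h
      by_contra! hc
      exact h (b ⟨0, by omega⟩) (funext fun j => hc _ _)
  rw [h, Finset.card_compl, Finset.card_image_of_injective]
  · simp
  · intro w w' hw; exact congrFun hw ⟨0, by omega⟩

lemma goodBatches_card_pos {N : ℕ} (hN : 2 ≤ N) : 0 < (goodBatches N).card := by
  rw [goodBatches_card hN]
  have := Nat.pow_le_pow_right (n := 2) (by norm_num) hN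
  omega

lemma candidates_card_pos {N : ℕ} {b : Qubits N} (hb : b ∈ goodBatches N) (w : Fin 2) :
    0 < (candidates b w).card := by
  obtain ⟨i, j, hij⟩ := (Finset.mem_filter.1 hb).2
  by_cases h : b i = w
  · exact Finset.card_pos.2 ⟨i, by simp [candidates, h]⟩
  · exact Finset.card_pos.2 ⟨j, Finset.mem_filter.2 ⟨Finset.mem_univ j, by omega⟩⟩

/-- The average over good batches, and over the candidates in them, of a constant. -/
lemma average_const {N : ℕ} (hN : 2 ≤ N) (w : Fin 2) (r : ℝ) :
    ((goodBatches N).card : ℝ)⁻¹ * ∑ b ∈ goodBatches N,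
      ((candidates b w).card : ℝ)⁻¹ * ∑ _i ∈ candidates b w, r = r := by
  have h : ∀ b ∈ goodBatches N, ((candidates b w).card : ℝ)⁻¹ * ∑ _i ∈ candidates b w, r = r := by
    intro b hb
    have : ((candidates b w).card : ℝ) ≠ 0 := by
      exact_mod_cast (candidates_card_pos hb w).ne'
    rw [Finset.sum_const, nsmul_eq_mul, inv_mul_cancel_left₀ this]
  have : ((goodBatches N).card : ℝ) ≠ 0 := by exact_mod_cast (goodBatches_card_pos hN).ne'
  rw [Finset.sum_congr rfl h, Finset.sum_const, nsmul_eq_mul, inv_mul_cancel_left₀ this]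

lemma honestPass_eq_one (P : Params) {N : ℕ} (b : Qubits N) : honestPass P b = 1 := by
  unfold honestPass
  have : ∑ s, star (P.batch b s) * P.batch b s = 1 := by
    rw [Fintype.sum_prod_type]
    have h : ∀ x, ∑ y, star (P.batch b (x, y)) * P.batch b (x, y) = (P.batchProb b x : ℂ) := by
      intro x
      rw [Finset.sum_eq_single x]
      · rw [P.star_batch, P.batch_self_mul]
      · intro y _ hy; simp [P.batch_eq, hy.symm]
      · simp
    simp only [h]
    rw [← Complex.ofReal_sum, P.sum_batchProb, Complex.ofReal_one]
  rw [this]; simp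

lemma honestToss_eq (P : Params) {N : ℕ} (b : Qubits N) (i : Fin N) (cA cB : Fin 2) :
    honestToss P b i cA cB = if cA = cB then P.prob (b i) cA else 0 := by
  unfold honestToss
  rw [Finset.sum_filter, Fintype.sum_prod_type]
  have h : ∀ x : Qubits N, ∑ y : Qubits N, (if x i = cB ∧ y i = cA then ‖P.batch b (x, y)‖ ^ 2
      else 0) = if x i = cB ∧ x i = cA then P.batchProb b x else 0 := by
    intro x
    rw [Finset.sum_eq_single x]
    · simp [P.norm_batch_sq]
    · intro y _ hy; simp [P.batch_eq, hy.symm]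
    · simp
  simp only [h]
  split_ifs with hc
  · subst hc; simpa using P.sum_batchProb_apply b i cA
  · exact Finset.sum_eq_zero fun x _ => if_neg fun hx => hc (hx.2.symm.trans hx.1)

lemma honestOut_eq (P : Params) {N : ℕ} (hN : 2 ≤ N) (M : ℕ) (w cA cB : Fin 2) :
    honestOut P N M w cA cB = if cA = cB then P.prob w cA else 0 := by
  unfold honestOut
  have h1 : ((goodBatches N).card : ℝ)⁻¹ * ∑ b ∈ goodBatches N, honestPass P b = 1 := by
    have : ((goodBatches N).card : ℝ) ≠ 0 := by exact_mod_cast (goodBatches_card_pos hN).ne'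
    simp [honestPass_eq_one, this]
  have h2 : ∀ b ∈ goodBatches N, ((candidates b w).card : ℝ)⁻¹ *
      ∑ i ∈ candidates b w, honestToss P b i cA cB = ((candidates b w).card : ℝ)⁻¹ *
      ∑ _i ∈ candidates b w, if cA = cB then P.prob w cA else 0 := by
    intro b _
    congr 1
    refine Finset.sum_congr rfl fun i hi => ?_
    rw [honestToss_eq, (Finset.mem_filter.1 hi).2]
  rw [h1, Finset.sum_congr rfl h2, average_const hN]
  simp only [one_pow, mul_one]
  rw [tsum_mul_right, (hasSum_trust M).tsum_eq, one_mul]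

/-! ### Distinguishing diagonal states -/

lemma abs_diagonal {m : Type} [Fintype m] [DecidableEq m] (d : m → ℝ) :
    CFC.abs (Matrix.diagonal fun x => (d x : ℂ)) = Matrix.diagonal fun x => ((|d x| : ℝ) : ℂ) := by
  refine CFC.sqrt_unique ?_ ?_
  · rw [Matrix.diagonal_mul_diagonal, Matrix.star_eq_conjTranspose, Matrix.diagonal_conjTranspose,
      Matrix.diagonal_mul_diagonal]
    congr 1
    funext x
    simp [← Complex.ofReal_mul]
  · rw [Matrix.nonneg_iff_posSemidef, Matrix.posSemidef_diagonal_iff]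
    intro x; simp

lemma traceDist_diagonal {m : Type} [Fintype m] [DecidableEq m] (p q : m → ℝ) :
    traceDist (Matrix.diagonal fun x => (p x : ℂ)) (Matrix.diagonal fun x => (q x : ℂ)) =
      (1 / 2) * ∑ x, |p x - q x| := by
  unfold traceDist
  rw [Matrix.diagonal_sub]
  have := abs_diagonal (fun x => p x - q x)
  simp only [Complex.ofReal_sub] at this
  rw [this, Matrix.trace_diagonal, Complex.re_sum]
  simp

lemma born_diagonal {m : Type} [Fintype m] [DecidableEq m] (E : Matrix m m ℂ) (d : m → ℝ) :
    born E (Matrix.diagonal fun x => (d x : ℂ)) = ∑ x, (E x x).re * d x := by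
  simp [born, Matrix.trace, Matrix.mul_diagonal]

/-- Maximum likelihood guessing is optimal for diagonal states: measure in the computational basis
and guess the more likely alternative. -/
lemma isGreatest_successProbs {m : Type} [Fintype m] [DecidableEq m] (η : ℝ)
    (d : Fin 2 → m → ℝ) :
    IsGreatest (successProbs η fun w => Matrix.diagonal fun x => (d w x : ℂ))
      (∑ x, max (prior η 0 * d 0 x) (prior η 1 * d 1 x)) := by
  constructor
  · let g : m → Fin 2 := fun x => if prior η 0 * d 0 x ≤ prior η 1 * d 1 x then 1 else 0
    refine ⟨⟨fun w => Matrix.diagonal fun x => if g x = w then 1 else 0, ?_, ?_⟩, ?_⟩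
    · intro w
      rw [Matrix.posSemidef_diagonal_iff]
      intro x; split_ifs <;> simp
    · rw [Fin.sum_univ_two, Matrix.diagonal_add, ← Matrix.diagonal_one]
      congr 1
      funext x
      by_cases h : prior η 0 * d 0 x ≤ prior η 1 * d 1 x <;> simp [g, h]
    · simp only [born_diagonal, Matrix.diagonal_apply_eq, Fin.sum_univ_two, Finset.mul_sum,
        ← Finset.sum_add_distrib]
      refine Finset.sum_congr rfl fun x _ => ?_
      by_cases h : prior η 0 * d 0 x ≤ prior η 1 * d 1 x
      · simp [g, h]
      · simp [g, h, le_of_not_ge h]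
  · rintro s ⟨G, rfl⟩
    simp only [born_diagonal, Fin.sum_univ_two, Finset.mul_sum, ← Finset.sum_add_distrib]
    refine Finset.sum_le_sum fun x _ => ?_
    have h1 : (G.E 0 x x).re + (G.E 1 x x).re = 1 := by
      have := congrFun (congrFun G.total x) x
      rw [Fin.sum_univ_two] at this
      simpa using congrArg Complex.re this
    have h0 : ∀ w, 0 ≤ (G.E w x x).re := fun w => (Complex.le_def.1 (G.pos w).diag_nonneg).1
    have e : max (prior η 0 * d 0 x) (prior η 1 * d 1 x) =
      (G.E 0 x x).re * max (prior η 0 * d 0 x) (prior η 1 * d 1 x) +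
      (G.E 1 x x).re * max (prior η 0 * d 0 x) (prior η 1 * d 1 x) := by
      rw [← add_mul, h1, one_mul]
    rw [e]
    refine add_le_add ?_ ?_
    · rw [mul_left_comm]
      exact mul_le_mul_of_nonneg_left (le_max_left _ _) (h0 0)
    · rw [mul_left_comm]
      exact mul_le_mul_of_nonneg_left (le_max_right _ _) (h0 1)

/-- A homogeneous function that is `1`-Lipschitz in its second argument hardly notices that its
arguments are multiplied by two different, but almost equal, probability distributions. -/
lemma abs_sum_homogeneous_sub_le {κ ι : Type} [Fintype κ] [Fintype ι] {F : ℝ → ℝ → ℝ}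
    (hF : ∀ a b b', |F a b - F a b'| ≤ |b - b'|)
    (hF' : ∀ a b t, 0 ≤ t → F (a * t) (b * t) = F a b * t) (a b : κ → ℝ) {s t : ι → ℝ}
    (hs : ∀ x, 0 ≤ s x) (hs1 : ∑ x, s x = 1) :
    |∑ y : κ × ι, F (a y.1 * s y.2) (b y.1 * t y.2) - ∑ c, F (a c) (b c)| ≤
      (∑ c, |b c|) * ∑ x, |s x - t x| := by
  have h : ∑ c, F (a c) (b c) = ∑ y : κ × ι, F (a y.1 * s y.2) (b y.1 * s y.2) := by
    rw [Fintype.sum_prod_type]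
    refine Finset.sum_congr rfl fun c _ => ?_
    rw [Finset.sum_congr rfl fun x _ => hF' (a c) (b c) (s x) (hs x), ← Finset.mul_sum, hs1,
      mul_one]
  rw [h, ← Finset.sum_sub_distrib, Finset.sum_mul_sum, ← Fintype.sum_prod_type']
  refine (Finset.abs_sum_le_sum_abs _ _).trans (Finset.sum_le_sum fun y _ => (hF _ _ _).trans ?_)
  rw [← mul_sub, abs_mul, abs_sub_comm]

/-! ### The states on which Alice's discrimination of Bob's inputs is based -/

namespace Params

variable (P : Params)

/-- The distribution of the outcomes when `σ_w`, for `n + 1` states, is measured in the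
computational basis. -/
noncomputable def sigmaDist (w : Fin 2) (n : ℕ) (x : Qubits n) : ℝ :=
  (2 ^ n - 1)⁻¹ * ∑ b ∈ Finset.univ.filter (fun b : Qubits n => ∃ j, b j ≠ w), P.batchProb b x

lemma rho_eq (i : Fin 2) : P.rho i = Matrix.diagonal fun c => (P.prob i c : ℂ) := by
  ext x x'
  simp only [rho, Matrix.of_apply, psi_eq, Matrix.diagonal_apply, ← amp_sq]
  by_cases h : x = x'
  · subst h; simp [pow_two]
  · simp [h]

lemma filter_ne_const (w : Fin 2) (n : ℕ) :
    Finset.univ.filter (fun b : Qubits n => ∃ j, b j ≠ w) = {fun _ => w}ᶜ := by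
  ext b; simp [funext_iff]

lemma sigmaTilde_eq (w : Fin 2) (n : ℕ) : P.sigmaTilde w n = Matrix.diagonal fun x =>
    ((∑ b ∈ Finset.univ.filter (fun b : Qubits n => ∃ j, b j ≠ w), P.batchProb b x : ℝ) : ℂ) := by
  ext x x'
  simp only [sigmaTilde, Matrix.sum_apply, Matrix.of_apply, rho_eq, Matrix.diagonal_apply]
  by_cases h : x = x'
  · subst h; simp [batchProb]
  · obtain ⟨j, hj⟩ := Function.ne_iff.1 h
    rw [if_neg h]
    exact Finset.sum_eq_zero fun b _ => Finset.prod_eq_zero (Finset.mem_univ j) (by simp [hj])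

lemma card_filter_ne_const (w : Fin 2) (n : ℕ) :
    ((Finset.univ.filter (fun b : Qubits n => ∃ j, b j ≠ w)).card : ℝ) = 2 ^ n - 1 := by
  rw [filter_ne_const, Finset.card_compl, Finset.card_singleton, Nat.cast_sub Fintype.card_pos]
  simp

lemma sigma_eq (w : Fin 2) (n : ℕ) :
    P.sigma w n = Matrix.diagonal fun x => (P.sigmaDist w n x : ℂ) := by
  have ht : (P.sigmaTilde w n).trace = ((2 ^ n - 1 : ℝ) : ℂ) := by
    rw [sigmaTilde_eq, Matrix.trace_diagonal, ← Complex.ofReal_sum, Finset.sum_comm]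
    simp only [sum_batchProb]
    rw [Finset.sum_const, nsmul_eq_mul, mul_one, card_filter_ne_const]
  rw [sigma, ht, sigmaTilde_eq, ← Matrix.diagonal_smul]
  congr 1
  funext x
  simp [sigmaDist]

lemma rhoSigma_eq (N : ℕ) (w : Fin 2) : P.rhoSigma N w = Matrix.diagonal fun y =>
    ((P.prob w y.1 * P.sigmaDist w (N - 1) y.2 : ℝ) : ℂ) := by
  rw [rhoSigma, rho_eq, sigma_eq, Matrix.diagonal_kronecker_diagonal]
  simp

lemma two_pow_sub_one_pos {n : ℕ} (hn : n ≠ 0) : (0 : ℝ) < 2 ^ n - 1 :=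
  sub_pos.2 (one_lt_pow₀ one_lt_two hn)

lemma sigmaDist_nonneg (w : Fin 2) (n : ℕ) (x : Qubits n) : 0 ≤ P.sigmaDist w n x :=
  mul_nonneg (inv_nonneg.2 (sub_nonneg.2 (one_le_pow₀ one_le_two)))
    (Finset.sum_nonneg fun b _ => P.batchProb_nonneg b x)

lemma sum_sigmaDist (w : Fin 2) {n : ℕ} (hn : n ≠ 0) : ∑ x, P.sigmaDist w n x = 1 := by
  simp only [sigmaDist]
  rw [← Finset.mul_sum, Finset.sum_comm]
  simp only [sum_batchProb]
  rw [Finset.sum_const, nsmul_eq_mul, mul_one, card_filter_ne_const,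
    inv_mul_cancel₀ (two_pow_sub_one_pos hn).ne']

/-- The two distributions differ only by the omission of different constant strings. -/
lemma sum_abs_sigmaDist_sub_le {n : ℕ} (hn : n ≠ 0) :
    ∑ x, |P.sigmaDist 0 n x - P.sigmaDist 1 n x| ≤ 2 * (2 ^ n - 1)⁻¹ := by
  have hp := two_pow_sub_one_pos hn
  have h : ∀ x, |P.sigmaDist 0 n x - P.sigmaDist 1 n x| ≤
      (2 ^ n - 1)⁻¹ * (P.batchProb (fun _ => 1) x + P.batchProb (fun _ => 0) x) := by
    intro x
    have e : ∀ w, P.sigmaDist w n x =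
        (2 ^ n - 1)⁻¹ * (∑ b, P.batchProb b x - P.batchProb (fun _ => w) x) := by
      intro w
      rw [sigmaDist, filter_ne_const, ← Finset.sum_compl_add_sum {fun _ => w}]
      simp
    rw [e, e, ← mul_sub, abs_mul, abs_of_pos (inv_pos.2 hp)]
    refine mul_le_mul_of_nonneg_left ?_ (inv_pos.2 hp).le
    have h0 := P.batchProb_nonneg (fun _ => 0) x
    have h1 := P.batchProb_nonneg (fun _ => 1) x
    rw [abs_le]; constructor <;> linarith
  refine (Finset.sum_le_sum fun x _ => h x).trans ?_
  rw [← Finset.mul_sum, Finset.sum_add_distrib, sum_batchProb, sum_batchProb]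
  linarith

lemma tendsto_inv_two_pow_pred_sub_one :
    Filter.Tendsto (fun N : ℕ => ((2 : ℝ) ^ (N - 1) - 1)⁻¹) Filter.atTop (nhds 0) := by
  refine Filter.Tendsto.inv_tendsto_atTop (Filter.tendsto_atTop_add_const_right _ _ ?_)
  exact (tendsto_pow_atTop_atTop_of_one_lt one_lt_two).comp (Filter.tendsto_sub_atTop_nat 1)

lemma tendsto_sum_homogeneous {F : ℝ → ℝ → ℝ}
    (hF : ∀ a b b', |F a b - F a b'| ≤ |b - b'|)
    (hF' : ∀ a b t, 0 ≤ t → F (a * t) (b * t) = F a b * t) (a b : Fin 2 → ℝ) :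
    Filter.Tendsto (fun N : ℕ => ∑ y : Fin 2 × Qubits (N - 1),
      F (a y.1 * P.sigmaDist 0 (N - 1) y.2) (b y.1 * P.sigmaDist 1 (N - 1) y.2))
      Filter.atTop (nhds (∑ c, F (a c) (b c))) := by
  rw [tendsto_iff_norm_sub_tendsto_zero]
  have hlim : Filter.Tendsto (fun N : ℕ => (∑ c, |b c|) * (2 * ((2 : ℝ) ^ (N - 1) - 1)⁻¹))
      Filter.atTop (nhds 0) := by
    simpa using (tendsto_inv_two_pow_pred_sub_one.const_mul 2).const_mul (∑ c, |b c|)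
  refine squeeze_zero' (Filter.Eventually.of_forall fun _ => norm_nonneg _) ?_ hlim
  filter_upwards [Filter.eventually_ge_atTop 2] with N hN
  have hn : N - 1 ≠ 0 := by omega
  exact (abs_sum_homogeneous_sub_le hF hF' a b (P.sigmaDist_nonneg 0 _)
    (P.sum_sigmaDist 0 hn)).trans (mul_le_mul_of_nonneg_left (P.sum_abs_sigmaDist_sub_le hn)
    (Finset.sum_nonneg fun _ _ => abs_nonneg _))

lemma tendsto_traceDist_sigma :
    Filter.Tendsto (fun N : ℕ => traceDist (P.sigma 0 (N - 1)) (P.sigma 1 (N - 1)))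
      Filter.atTop (nhds 0) := by
  simp only [sigma_eq, traceDist_diagonal]
  refine squeeze_zero' (Filter.Eventually.of_forall fun N => by positivity) ?_
    tendsto_inv_two_pow_pred_sub_one
  filter_upwards [Filter.eventually_ge_atTop 2] with N hN
  have := P.sum_abs_sigmaDist_sub_le (n := N - 1) (by omega)
  linarith

lemma tendsto_traceDist_rhoSigma :
    Filter.Tendsto (fun N : ℕ => traceDist (P.rhoSigma N 0) (P.rhoSigma N 1))
      Filter.atTop (nhds (traceDist (P.rho 0) (P.rho 1))) := by
  simp only [rhoSigma_eq, rho_eq, traceDist_diagonal]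
  refine Filter.Tendsto.const_mul _ (P.tendsto_sum_homogeneous (F := fun a b => |a - b|) ?_ ?_ _ _)
  · intro a b b'
    refine (abs_abs_sub_abs_le_abs_sub _ _).trans_eq ?_
    rw [sub_sub_sub_cancel_left, abs_sub_comm]
  · intro a b t ht
    rw [← sub_mul, abs_mul, abs_of_nonneg ht]

lemma isGreatest_successProbs_rho (η : ℝ) : IsGreatest (successProbs η P.rho)
    (∑ c, max (prior η 0 * P.prob 0 c) (prior η 1 * P.prob 1 c)) := by
  rw [show P.rho = fun w => Matrix.diagonal fun c => (P.prob w c : ℂ) from funext P.rho_eq]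
  exact isGreatest_successProbs η P.prob

lemma tendsto_sSup_successProbs (η : ℝ) :
    Filter.Tendsto (fun N : ℕ => sSup (successProbs η (P.rhoSigma N)))
      Filter.atTop (nhds (sSup (successProbs η P.rho))) := by
  have h : ∀ N, sSup (successProbs η (P.rhoSigma N)) = ∑ y : Fin 2 × Qubits (N - 1),
      max (prior η 0 * P.prob 0 y.1 * P.sigmaDist 0 (N - 1) y.2)
        (prior η 1 * P.prob 1 y.1 * P.sigmaDist 1 (N - 1) y.2) := by
    intro N
    rw [show P.rhoSigma N = fun w => _ from funext (P.rhoSigma_eq N)]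
    refine (isGreatest_successProbs η fun w (y : Fin 2 × Qubits (N - 1)) =>
      P.prob w y.1 * P.sigmaDist w (N - 1) y.2).csSup_eq.trans ?_
    simp only [mul_assoc]
  simp only [h, (P.isGreatest_successProbs_rho η).csSup_eq]
  refine P.tendsto_sum_homogeneous (F := max) ?_ ?_ (fun c => prior η 0 * P.prob 0 c)
    (fun c => prior η 1 * P.prob 1 c)
  · intro a b b'
    simpa using abs_max_sub_max_le_max a b a b'
  · intro a b t ht
    exact (max_mul_of_nonneg a b ht).symm

lemma exists_guess (η : ℝ) : ∃ guess : Fin 2 → Fin 2,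
    IsGreatest (successProbs η P.rho) (∑ c, prior η (guess c) * P.prob (guess c) c) := by
  refine ⟨fun c => if prior η 0 * P.prob 0 c ≤ prior η 1 * P.prob 1 c then 1 else 0, ?_⟩
  convert P.isGreatest_successProbs_rho η using 2 with c
  dsimp only
  split_ifs with h
  · rw [max_eq_right h]
  · rw [max_eq_left (le_of_not_ge h)]

end Params

/-! ### Effects, states and instruments -/

section Kronecker

variable {l m n p ι : Type}

lemma kronecker_sum (s : Finset ι) (A : Matrix l m ℂ) (B : ι → Matrix n p ℂ) :
    A ⊗ₖ (∑ i ∈ s, B i) = ∑ i ∈ s, A ⊗ₖ B i := by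
  ext; simp [Matrix.sum_apply, Finset.mul_sum]

lemma sum_kronecker (s : Finset ι) (A : ι → Matrix l m ℂ) (B : Matrix n p ℂ) :
    (∑ i ∈ s, A i) ⊗ₖ B = ∑ i ∈ s, A i ⊗ₖ B := by
  ext; simp [Matrix.sum_apply, Finset.sum_mul]

lemma kronecker_sub (A : Matrix l m ℂ) (B C : Matrix n p ℂ) : A ⊗ₖ (B - C) = A ⊗ₖ B - A ⊗ₖ C := by
  ext; simp [mul_sub]

lemma sub_kronecker (A B : Matrix l m ℂ) (C : Matrix n p ℂ) : (A - B) ⊗ₖ C = A ⊗ₖ C - B ⊗ₖ C := by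
  ext; simp [sub_mul]

end Kronecker

section Born

variable {m n X : Type} [Fintype m] [Fintype n] [Fintype X]

lemma born_sub_left (E F ω : Matrix m m ℂ) : born (E - F) ω = born E ω - born F ω := by
  simp [born, Matrix.sub_mul]

lemma born_sum_left {ι : Type} (s : Finset ι) (E : ι → Matrix m m ℂ) (ω : Matrix m m ℂ) :
    born (∑ i ∈ s, E i) ω = ∑ i ∈ s, born (E i) ω := by
  simp [born, Finset.sum_mul, Matrix.trace_sum]

lemma born_sum_right {ι : Type} (s : Finset ι) (E : Matrix m m ℂ) (ω : ι → Matrix m m ℂ) :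
    born E (∑ i ∈ s, ω i) = ∑ i ∈ s, born E (ω i) := by
  simp [born, Finset.mul_sum, Matrix.trace_sum]

lemma born_smul_left (r : ℝ) (E ω : Matrix m m ℂ) : born ((r : ℂ) • E) ω = r * born E ω := by
  simp [born]

lemma born_one [DecidableEq m] (ω : Matrix m m ℂ) : born 1 ω = ω.trace.re := by
  simp [born]

/-- Passing from the Schrödinger to the Heisenberg picture. -/
lemma born_conj (E : Matrix n n ℂ) (K : Matrix n m ℂ) (ω : Matrix m m ℂ) :
    born E (K * ω * Kᴴ) = born (Kᴴ * E * K) ω := by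
  unfold born
  rw [← Matrix.mul_assoc, ← Matrix.mul_assoc, Matrix.trace_mul_comm, ← Matrix.mul_assoc,
    ← Matrix.mul_assoc]

lemma born_nonneg {E ω : Matrix m m ℂ} (hE : E.PosSemidef) (hω : ω.PosSemidef) :
    0 ≤ born E ω := by
  classical
  obtain ⟨B, rfl⟩ := CStarAlgebra.nonneg_iff_eq_star_mul_self.1 hE.nonneg
  rw [Matrix.star_eq_conjTranspose]
  have h : born (1 : Matrix m m ℂ) (B * ω * Bᴴ) = born (Bᴴ * B) ω := by
    rw [born_conj, Matrix.mul_one]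
  rw [← h, born_one]
  exact (Complex.le_def.1 (hω.mul_mul_conjTranspose_same B).trace_nonneg).1

lemma born_mono {E F ω : Matrix m m ℂ} (h : (F - E).PosSemidef) (hω : ω.PosSemidef) :
    born E ω ≤ born F ω := by
  rw [← sub_nonneg, ← born_sub_left]
  exact born_nonneg h hω

variable [DecidableEq m]

lemma POVM.posSemidef_one_sub (G : POVM X m) (x : X) : (1 - G.E x).PosSemidef := by
  classical
  rw [← G.total, ← Finset.add_sum_erase _ _ (Finset.mem_univ x), add_sub_cancel_left]
  exact Matrix.posSemidef_sum _ fun y _ => G.pos y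

/-- The operations of an instrument define a measurement. -/
def Instrument.toPOVM (I : Instrument X m n) : POVM X m where
  E x := ∑ j, (I.K x j)ᴴ * I.K x j
  pos _ := Matrix.posSemidef_sum _ fun _ _ => Matrix.posSemidef_conjTranspose_mul_self _
  total := I.complete

lemma Instrument.posSemidef_channel (I : Instrument Unit m n) {ρ : Matrix m m ℂ}
    (h : ρ.PosSemidef) : (I.channel ρ).PosSemidef :=
  Matrix.posSemidef_sum _ fun _ _ => h.mul_mul_conjTranspose_same _

lemma Instrument.trace_channel [DecidableEq n] (I : Instrument Unit m n) (ρ : Matrix m m ℂ) :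
    (I.channel ρ).trace.re = ρ.trace.re := by
  have h := I.complete
  rw [Fintype.sum_unique] at h
  rw [← born_one, Instrument.channel, born_sum_right, ← born_one ρ]
  simp only [born_conj, Matrix.mul_one]
  rw [← born_sum_left]
  congr 1

/-- A quantitative form of the fact that a state with support in the range of a projection is
independent of what commutes with it. Here `Vᴴ * V` is the projection, which commutes with the
effect `Z`, and the term in parentheses is the weight of `Z` in the orthogonal complement of its
range. -/
lemma born_le_of_coisometry [DecidableEq n] {V : Matrix n m ℂ} {X Z ω : Matrix m m ℂ}
    {Y : Matrix n n ℂ} {r ε : ℝ} (hV : V * Vᴴ = 1) (hω : ω.PosSemidef) (hX : X.PosSemidef)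
    (hXZ : (Z - X).PosSemidef) (hZ : V * Z = Y * V) (hr : V * X * Vᴴ = (r : ℂ) • Y)
    (hε : 0 < ε) :
    0 ≤ born Z ω - born Y (V * ω * Vᴴ) ∧
    born X ω ≤ (1 + ε) * (r * born Y (V * ω * Vᴴ)) +
      (1 + 1 / ε) * (born Z ω - born Y (V * ω * Vᴴ)) := by
  have hZp : Z.PosSemidef := by simpa using hXZ.add hX
  set Q := Vᴴ * V with hQ
  have hQh : Qᴴ = Q := by simp [hQ]
  have hQ2 : Q * Q = Q := by
    rw [hQ, Matrix.mul_assoc, ← Matrix.mul_assoc V, hV, Matrix.one_mul]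
  have hY : Y = V * Z * Vᴴ := by rw [hZ, Matrix.mul_assoc, hV, Matrix.mul_one]
  have hYh : Yᴴ = Y := by
    rw [hY]; simp [Matrix.mul_assoc, hZp.1.eq]
  have hQZ : Q * Z = Z * Q := by
    have h1 : Q * Z = Vᴴ * Y * V := by rw [hQ, Matrix.mul_assoc, hZ, Matrix.mul_assoc]
    have h2 : (Q * Z)ᴴ = Q * Z := by rw [h1]; simp [Matrix.mul_assoc, hYh]
    rw [← h2, Matrix.conjTranspose_mul, hZp.1.eq, hQh]
  have key : ∀ A : Matrix m m ℂ, born A (Q * ω * Q) = born (V * A * Vᴴ) (V * ω * Vᴴ) := by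
    intro A
    have h := born_conj A Vᴴ (V * ω * Vᴴ)
    rw [Matrix.conjTranspose_conjTranspose] at h
    rw [← h, hQ]; simp only [Matrix.mul_assoc]
  have hoff : ∀ A : Matrix m m ℂ, born A ((1 - Q) * ω * (1 - Q)) =
      born ((1 - Q) * A * (1 - Q)) ω := by
    intro A
    have h := born_conj A (1 - Q) ω
    rwa [Matrix.conjTranspose_sub, Matrix.conjTranspose_one, hQh] at h
  have hperp : ((1 - Q) * ω * (1 - Q)).PosSemidef := by
    have := hω.mul_mul_conjTranspose_same (1 - Q)
    rwa [Matrix.conjTranspose_sub, Matrix.conjTranspose_one, hQh] at this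
  have hdef : born Z ω - born Y (V * ω * Vᴴ) = born Z ((1 - Q) * ω * (1 - Q)) := by
    rw [hoff, hY, ← key]
    have h := born_conj Z Q ω
    rw [hQh] at h
    rw [h, ← born_sub_left]
    congr 1
    rw [hQZ, Matrix.mul_assoc, hQ2, Matrix.sub_mul, Matrix.one_mul, hQZ, ← Matrix.mul_one Z,
      Matrix.mul_assoc Z, Matrix.one_mul, ← Matrix.mul_sub, Matrix.mul_assoc]
    congr 1
    rw [Matrix.sub_mul, Matrix.one_mul, Matrix.mul_sub, hQ2, Matrix.mul_one, sub_self, sub_zero]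
  rw [hdef]
  refine ⟨born_nonneg hZp hperp, ?_⟩
  have hQX : r * born Y (V * ω * Vᴴ) = born X (Q * ω * Q) := by
    rw [key, hr, born_smul_left]
  rw [hQX]
  have hmono : born X ((1 - Q) * ω * (1 - Q)) ≤ born Z ((1 - Q) * ω * (1 - Q)) :=
    born_mono hXZ hperp
  -- positivity of `X` in the vectors `ε Q v - (1 - Q) v` bounds the cross terms
  have hcross : 0 ≤ born X (((ε : ℂ) • Q - (1 - Q)) * ω * ((ε : ℂ) • Q - (1 - Q))) := by
    have := hω.mul_mul_conjTranspose_same ((ε : ℂ) • Q - (1 - Q))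
    rw [Matrix.conjTranspose_sub, Matrix.conjTranspose_sub, Matrix.conjTranspose_smul,
      Matrix.conjTranspose_one, hQh, Complex.star_def, Complex.conj_ofReal] at this
    exact born_nonneg hX this
  have hsplit : ε * born X ω = (ε + ε ^ 2) * born X (Q * ω * Q) +
      (ε + 1) * born X ((1 - Q) * ω * (1 - Q)) -
      born X (((ε : ℂ) • Q - (1 - Q)) * ω * ((ε : ℂ) • Q - (1 - Q))) := by
    simp only [born, Matrix.mul_sub, Matrix.sub_mul, Matrix.one_mul, Matrix.mul_one,
      Matrix.smul_mul, Matrix.mul_smul, Matrix.trace_sub, Matrix.trace_smul, Complex.sub_re,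
      smul_eq_mul, Complex.re_ofReal_mul]
    ring
  have hε' : (1 + 1 / ε) * ε = ε + 1 := by field_simp
  refine le_of_mul_le_mul_left ?_ hε
  rw [hsplit]
  have h1 := mul_le_mul_of_nonneg_left hmono (by linarith : 0 ≤ ε + 1)
  have h2 : ε * ((1 + ε) * born X (Q * ω * Q) + (1 + 1 / ε) *
      born Z ((1 - Q) * ω * (1 - Q))) = (ε + ε ^ 2) * born X (Q * ω * Q) +
      (ε + 1) * born Z ((1 - Q) * ω * (1 - Q)) := by
    rw [← hε']; ring
  rw [h2]; linarith

end Born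

/-! ### The test of a batch -/

lemma batchBra_mul (P : Params) {N m₁ m₂ m₂' : ℕ} (b : Qubits N)
    (L : Matrix (Fin m₂') (Fin m₂) ℂ) :
    batchBra P (m₁ := m₁) (m₂ := m₂') b * ((1 : Matrix (Qubits N) (Qubits N) ℂ) ⊗ₖ
      ((1 : Matrix (Qubits N × Fin m₁) (Qubits N × Fin m₁) ℂ) ⊗ₖ L)) =
    ((1 : Matrix (Fin m₁) (Fin m₁) ℂ) ⊗ₖ L) * batchBra P (m₁ := m₁) (m₂ := m₂) b := by
  ext ⟨a₁, a₂⟩ ⟨x, ⟨y, e₁⟩, e₂⟩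
  simp only [Matrix.mul_apply, batchBra, Matrix.of_apply, Matrix.kroneckerMap_apply,
    Matrix.one_apply, Fintype.sum_prod_type, Prod.mk.injEq, ite_and, ite_mul, mul_ite, zero_mul,
    mul_zero, one_mul, Finset.sum_ite_eq', Finset.mem_univ, if_true]
  by_cases h : a₁ = e₁
  · subst h; simp [mul_comm]
  · simp [h]

/-- In the state `|Ψ_b⟩`, whatever is measured in the computational basis on the qubits of `A₁` has
the distribution `batchProb b`, independently of the rest. -/
lemma batchBra_sandwich (P : Params) {N m₁ m₂ : ℕ} (b : Qubits N) (D : Qubits N → ℝ)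
    (Y : Matrix (Fin m₂) (Fin m₂) ℂ) :
    batchBra P (m₁ := m₁) (m₂ := m₂) b * (Matrix.diagonal (fun x => (D x : ℂ)) ⊗ₖ
      ((1 : Matrix (Qubits N × Fin m₁) (Qubits N × Fin m₁) ℂ) ⊗ₖ Y)) *
      (batchBra P (m₁ := m₁) (m₂ := m₂) b)ᴴ =
    ((∑ x, D x * P.batchProb b x : ℝ) : ℂ) • ((1 : Matrix (Fin m₁) (Fin m₁) ℂ) ⊗ₖ Y) := by
  have h1 : Matrix.diagonal (fun x => (D x : ℂ)) ⊗ₖ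
      ((1 : Matrix (Qubits N × Fin m₁) (Qubits N × Fin m₁) ℂ) ⊗ₖ Y) =
      ((1 : Matrix (Qubits N) (Qubits N) ℂ) ⊗ₖ
        ((1 : Matrix (Qubits N × Fin m₁) (Qubits N × Fin m₁) ℂ) ⊗ₖ Y)) *
      (Matrix.diagonal (fun x => (D x : ℂ)) ⊗ₖ
        ((1 : Matrix (Qubits N × Fin m₁) (Qubits N × Fin m₁) ℂ) ⊗ₖ
          (1 : Matrix (Fin m₂) (Fin m₂) ℂ))) := by
    simp only [← Matrix.mul_kronecker_mul, Matrix.one_mul, Matrix.mul_one]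
  have h2 : batchBra P (m₁ := m₁) (m₂ := m₂) b * (Matrix.diagonal (fun x => (D x : ℂ)) ⊗ₖ
      ((1 : Matrix (Qubits N × Fin m₁) (Qubits N × Fin m₁) ℂ) ⊗ₖ
        (1 : Matrix (Fin m₂) (Fin m₂) ℂ))) * (batchBra P (m₁ := m₁) (m₂ := m₂) b)ᴴ =
      ((∑ x, D x * P.batchProb b x : ℝ) : ℂ) • (1 : Matrix (Fin m₁ × Fin m₂) _ ℂ) := by
    rw [Matrix.one_kronecker_one, ← Matrix.diagonal_one, Matrix.diagonal_kronecker_diagonal]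
    ext ⟨a₁, a₂⟩ ⟨c₁, c₂⟩
    rw [Matrix.mul_apply]
    simp only [Matrix.mul_diagonal, Matrix.conjTranspose_apply, batchBra, Matrix.of_apply,
      Fintype.sum_prod_type, Prod.mk.injEq, ite_and, ite_mul, mul_ite, zero_mul, mul_zero, mul_one,
      apply_ite star, star_zero, Matrix.smul_apply, Matrix.one_apply, smul_eq_mul, P.star_batch]
    by_cases hc : c₁ = a₁
    · by_cases hc' : c₂ = a₂
      · subst hc hc'
        simp only [if_true]
        push_cast
        refine Finset.sum_congr rfl fun x _ => ?_
        rw [Finset.sum_eq_single x]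
        · rw [mul_right_comm, P.batch_self_mul, mul_comm]
          rw [Finset.sum_eq_single c₁ (fun e _ he => by simp [Ne.symm he]) (by simp),
            Finset.sum_eq_single c₂ (fun e _ he => by simp [Ne.symm he]) (by simp)]
          simp
        · intro y _ hy; simp [P.batch_eq, hy]
        · simp
      · simp [Ne.symm hc']
    · simp [Ne.symm hc]
  rw [h1, ← Matrix.mul_assoc, batchBra_mul, Matrix.mul_assoc, Matrix.mul_assoc,
    ← Matrix.mul_assoc (batchBra P (m₁ := m₁) (m₂ := m₂) b), h2, Matrix.mul_smul, Matrix.mul_one]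

lemma batchBra_coisometry (P : Params) {N m₁ m₂ : ℕ} (b : Qubits N) :
    batchBra P (m₁ := m₁) (m₂ := m₂) b * (batchBra P (m₁ := m₁) (m₂ := m₂) b)ᴴ = 1 := by
  have h := batchBra_sandwich P (m₁ := m₁) (m₂ := m₂) b (fun _ => 1) 1
  simpa [P.sum_batchProb, Matrix.diagonal_one] using h

lemma proj_eq {N : ℕ} (i : Fin N) (c : Fin 2) :
    proj i c = Matrix.diagonal fun x => ((if x i = c then 1 else 0 : ℝ) : ℂ) := by
  unfold proj; congr 1; funext x; split_ifs <;> simp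

lemma posSemidef_proj {N : ℕ} (i : Fin N) (c : Fin 2) : (proj i c).PosSemidef := by
  rw [proj, Matrix.posSemidef_diagonal_iff]; intro x; split_ifs <;> simp

lemma posSemidef_one_sub_proj {N : ℕ} (i : Fin N) (c : Fin 2) : (1 - proj i c).PosSemidef := by
  rw [proj, ← Matrix.diagonal_one, Matrix.diagonal_sub, Matrix.posSemidef_diagonal_iff]
  intro x; by_cases h : x i = c <;> simp [h]

lemma batchBra_proj_sandwich (P : Params) {N m₁ m₂ : ℕ} (b : Qubits N) (i : Fin N) (c : Fin 2)
    (Y : Matrix (Fin m₂) (Fin m₂) ℂ) :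
    batchBra P (m₁ := m₁) (m₂ := m₂) b * (proj i c ⊗ₖ
      ((1 : Matrix (Qubits N × Fin m₁) (Qubits N × Fin m₁) ℂ) ⊗ₖ Y)) *
      (batchBra P (m₁ := m₁) (m₂ := m₂) b)ᴴ =
    (P.prob (b i) c : ℂ) • ((1 : Matrix (Fin m₁) (Fin m₁) ℂ) ⊗ₖ Y) := by
  rw [proj_eq, batchBra_sandwich]
  simp [← P.sum_batchProb_apply]

namespace BobStrategy

variable {N : ℕ} (S : BobStrategy N) (P : Params)

lemma posSemidef_memory (k : ℕ) : (S.memory P k).PosSemidef := by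
  induction k with
  | zero => exact S.start_density.1
  | succ k ih =>
    exact Matrix.posSemidef_sum _ fun b _ => Matrix.posSemidef_sum _ fun j _ =>
      Matrix.posSemidef_sum _ fun l _ =>
        ((S.prep k).posSemidef_channel ih).mul_mul_conjTranspose_same _

lemma posSemidef_state (k : ℕ) : (S.state P k).PosSemidef :=
  (S.prep k).posSemidef_channel (S.posSemidef_memory P k)

lemma survive_eq (k : ℕ) : S.survive P k = born 1 (S.state P k) := by
  rw [born_one, state, Instrument.trace_channel, survive]

lemma survive_zero : S.survive P 0 = 1 := by
  simp [survive, memory, S.start_density.2]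

lemma survive_nonneg (k : ℕ) : 0 ≤ S.survive P k :=
  (Complex.le_def.1 (S.posSemidef_memory P k).trace_nonneg).1

/-- The Kraus operators, in round `k`, of the operation of `B₁` that replies to a test. -/
noncomputable def reply (k : ℕ) (b : Qubits N) (j : Fin (S.test₁ k).r) :
    Matrix (Qubits N × ((Qubits N × Fin (S.m₁ (k + 1))) × Fin (S.d₂ k)))
      (Qubits N × (Fin (S.d₁ k) × Fin (S.d₂ k))) ℂ :=
  (1 : Matrix (Qubits N) (Qubits N) ℂ) ⊗ₖ
    ((S.test₁ k).K b j ⊗ₖ (1 : Matrix (Fin (S.d₂ k)) (Fin (S.d₂ k)) ℂ))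

/-- The state after `B₁` has replied to a test with the string `b`, and before `B₂` acts. -/
noncomputable def replied (k : ℕ) (b : Qubits N) (j : Fin (S.test₁ k).r) :
    Matrix (Qubits N × ((Qubits N × Fin (S.m₁ (k + 1))) × Fin (S.d₂ k)))
      (Qubits N × ((Qubits N × Fin (S.m₁ (k + 1))) × Fin (S.d₂ k))) ℂ :=
  S.reply k b j * S.state P k * (S.reply k b j)ᴴ

/-- The partial bra of the batch `b`, with the identity on the memory of `B₁` after its reply and on
the system that `B₂` held when `z` was announced. -/
noncomputable def bra (k : ℕ) (b : Qubits N) : Matrix (Fin (S.m₁ (k + 1)) × Fin (S.d₂ k))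
    (Qubits N × ((Qubits N × Fin (S.m₁ (k + 1))) × Fin (S.d₂ k))) ℂ :=
  batchBra P b

/-- The state after `B₁` has replied to a test with the string `b`, and the qubits have been
projected onto the batch `b`, before `B₂` acts. -/
noncomputable def projected (k : ℕ) (b : Qubits N) (j : Fin (S.test₁ k).r) :
    Matrix (Fin (S.m₁ (k + 1)) × Fin (S.d₂ k)) (Fin (S.m₁ (k + 1)) × Fin (S.d₂ k)) ℂ :=
  S.bra P k b * S.replied P k b j * (S.bra P k b)ᴴ

/-- The weight in round `k` of the event that `B₁` replies to a test with the string `b`, that the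
qubits are projected onto the batch `b`, and that the effect `Y` is found on the system that `B₂`
held when `z` was announced. -/
noncomputable def accepted (k : ℕ) (b : Qubits N) (Y : Matrix (Fin (S.d₂ k)) (Fin (S.d₂ k)) ℂ) :
    ℝ :=
  ∑ j, born ((1 : Matrix (Fin (S.m₁ (k + 1))) (Fin (S.m₁ (k + 1))) ℂ) ⊗ₖ Y)
    (S.projected P k b j)

/-- The weight in round `k` of the event that the projection fails in a test, and that the effect
`Y` is found on the system that `B₂` held when `z` was announced. -/
noncomputable def deficit (k : ℕ) (Y : Matrix (Fin (S.d₂ k)) (Fin (S.d₂ k)) ℂ) : ℝ :=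
  born ((1 : Matrix (Qubits N) (Qubits N) ℂ) ⊗ₖ
    ((1 : Matrix (Fin (S.d₁ k)) (Fin (S.d₁ k)) ℂ) ⊗ₖ Y)) (S.state P k) -
    ∑ b, S.accepted P k b Y

lemma posSemidef_replied (k : ℕ) (b : Qubits N) (j : Fin (S.test₁ k).r) :
    (S.replied P k b j).PosSemidef :=
  (S.posSemidef_state P k).mul_mul_conjTranspose_same _

lemma posSemidef_projected (k : ℕ) (b : Qubits N) (j : Fin (S.test₁ k).r) :
    (S.projected P k b j).PosSemidef :=
  (S.posSemidef_replied P k b j).mul_mul_conjTranspose_same _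

lemma accepted_nonneg (k : ℕ) (b : Qubits N) {Y : Matrix (Fin (S.d₂ k)) (Fin (S.d₂ k)) ℂ}
    (hY : Y.PosSemidef) : 0 ≤ S.accepted P k b Y :=
  Finset.sum_nonneg fun j _ => born_nonneg (Matrix.PosSemidef.one.kronecker hY)
    (S.posSemidef_projected P k b j)

/-- What `B₁` does cannot be noticed by the others. -/
lemma sum_born_replied (k : ℕ) (X : Matrix (Qubits N) (Qubits N) ℂ)
    (Y : Matrix (Fin (S.d₂ k)) (Fin (S.d₂ k)) ℂ) :
    ∑ b, ∑ j, born (X ⊗ₖ ((1 : Matrix (Qubits N × Fin (S.m₁ (k + 1))) _ ℂ) ⊗ₖ Y))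
      (S.replied P k b j) =
    born (X ⊗ₖ ((1 : Matrix (Fin (S.d₁ k)) (Fin (S.d₁ k)) ℂ) ⊗ₖ Y)) (S.state P k) := by
  have h : ∀ b j, born (X ⊗ₖ ((1 : Matrix (Qubits N × Fin (S.m₁ (k + 1))) _ ℂ) ⊗ₖ Y))
      (S.replied P k b j) = born (X ⊗ₖ
        ((((S.test₁ k).K b j)ᴴ * (S.test₁ k).K b j) ⊗ₖ Y)) (S.state P k) := by
    intro b j
    rw [replied, born_conj, reply]
    simp only [Matrix.conjTranspose_kronecker, ← Matrix.mul_kronecker_mul,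
      Matrix.conjTranspose_one, Matrix.one_mul, Matrix.mul_one]
  simp only [h, ← born_sum_left, ← kronecker_sum, ← sum_kronecker, (S.test₁ k).complete]

/-- If the test would be passed with certainty then, given the reply `b` of `B₁`, the qubits of
`A₁` are independent of the system of `B₂`, and distributed as in the batch `b`. The deficit
measures the failure of this. -/
lemma deficit_nonneg_and_born_proj_le (k : ℕ) (i : Fin N) (c : Fin 2) {ε : ℝ} (hε : 0 < ε)
    {Y : Matrix (Fin (S.d₂ k)) (Fin (S.d₂ k)) ℂ} (hY : Y.PosSemidef) :
    0 ≤ S.deficit P k Y ∧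
    born (proj i c ⊗ₖ ((1 : Matrix (Fin (S.d₁ k)) (Fin (S.d₁ k)) ℂ) ⊗ₖ Y)) (S.state P k) ≤
      (1 + ε) * (∑ b, P.prob (b i) c * S.accepted P k b Y) +
      (1 + 1 / ε) * S.deficit P k Y := by
  have h1Y := (Matrix.PosSemidef.one (n := Qubits N × Fin (S.m₁ (k + 1))) (R := ℂ)).kronecker hY
  have key := fun b j => born_le_of_coisometry (V := S.bra P k b) (batchBra_coisometry P b)
    (S.posSemidef_replied P k b j) ((posSemidef_proj i c).kronecker h1Y)
    (Z := (1 : Matrix (Qubits N) (Qubits N) ℂ) ⊗ₖ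
      ((1 : Matrix (Qubits N × Fin (S.m₁ (k + 1))) _ ℂ) ⊗ₖ Y))
    (by rw [← sub_kronecker]; exact (posSemidef_one_sub_proj i c).kronecker h1Y)
    (batchBra_mul P b Y) (batchBra_proj_sandwich P b i c Y) hε
  have hd : S.deficit P k Y = ∑ b, ∑ j, (born ((1 : Matrix (Qubits N) (Qubits N) ℂ) ⊗ₖ
      ((1 : Matrix (Qubits N × Fin (S.m₁ (k + 1))) _ ℂ) ⊗ₖ Y)) (S.replied P k b j) -
      born ((1 : Matrix (Fin (S.m₁ (k + 1))) (Fin (S.m₁ (k + 1))) ℂ) ⊗ₖ Y)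
        (S.projected P k b j)) := by
    simp only [deficit, accepted, ← sum_born_replied S P k 1 Y, Finset.sum_sub_distrib]
  refine ⟨?_, ?_⟩
  · rw [hd]
    exact Finset.sum_nonneg fun b _ => Finset.sum_nonneg fun j _ => (key b j).1
  · rw [hd, ← sum_born_replied S P k (proj i c) Y]
    simp only [accepted, Finset.mul_sum, ← Finset.sum_add_distrib]
    refine Finset.sum_le_sum fun b _ => Finset.sum_le_sum fun j _ => (key b j).2.trans_eq ?_
    simp only [projected]

lemma sum_accepted (k : ℕ) (b : Qubits N) :
    ∑ t, S.accepted P k b ((S.coin₂ k).E t) = S.accepted P k b 1 := by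
  simp only [accepted]
  rw [Finset.sum_comm]
  refine Finset.sum_congr rfl fun j _ => ?_
  rw [← born_sum_left]
  rw [← kronecker_sum, (S.coin₂ k).total]

lemma sum_announceWeight (k : ℕ) : ∑ t, S.announceWeight P k t = S.survive P k := by
  rw [survive_eq]
  simp only [announceWeight]
  rw [← born_sum_left]
  simp only [← kronecker_sum, (S.coin₂ k).total, Matrix.one_kronecker_one]

lemma announceWeight_nonneg (k : ℕ) (t : Fin N × Fin (S.R k)) : 0 ≤ S.announceWeight P k t :=
  born_nonneg (Matrix.PosSemidef.one.kronecker (Matrix.PosSemidef.one.kronecker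
    ((S.coin₂ k).pos t))) (S.posSemidef_state P k)

lemma passKraus_eq (k : ℕ) (b : Qubits N) (j : Fin (S.test₁ k).r) (l : Fin (S.test₂ k).r) :
    S.passKraus P k b j l = ((1 : Matrix (Fin (S.m₁ (k + 1))) (Fin (S.m₁ (k + 1))) ℂ) ⊗ₖ
      (S.test₂ k).K b l) * S.bra P k b * S.reply k b j := by
  -- the product in `passKraus` is that of `CStarMatrix`, by definition equal to that of `Matrix`
  have h : S.passKraus P k b j l = batchBra P (m₁ := S.m₁ (k + 1)) (m₂ := S.m₂ (k + 1)) b *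
      ((1 : Matrix (Qubits N) (Qubits N) ℂ) ⊗ₖ ((S.test₁ k).K b j ⊗ₖ (S.test₂ k).K b l)) := rfl
  rw [h, bra, ← batchBra_mul, reply, Matrix.mul_assoc]
  simp only [← Matrix.mul_kronecker_mul, Matrix.one_mul, Matrix.mul_one]

/-- Passing the test requires at least that the projection succeeds for the reply of `B₁`. -/
lemma survive_succ_le (k : ℕ) : S.survive P (k + 1) ≤ ∑ b, S.accepted P k b 1 := by
  rw [survive, memory, ← born_one]
  change born 1 (∑ b, ∑ j, ∑ l, S.passKraus P k b j l * S.state P k * (S.passKraus P k b j l)ᴴ) ≤ _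
  simp only [born_sum_right]
  refine Finset.sum_le_sum fun b _ => ?_
  rw [accepted]
  refine Finset.sum_le_sum fun j _ => ?_
  have h : ∀ l, S.passKraus P k b j l * S.state P k * (S.passKraus P k b j l)ᴴ =
      ((1 : Matrix (Fin (S.m₁ (k + 1))) (Fin (S.m₁ (k + 1))) ℂ) ⊗ₖ (S.test₂ k).K b l) *
        S.projected P k b j *
      ((1 : Matrix (Fin (S.m₁ (k + 1))) (Fin (S.m₁ (k + 1))) ℂ) ⊗ₖ (S.test₂ k).K b l)ᴴ := by
    intro l
    simp only [passKraus_eq, projected, replied, Matrix.conjTranspose_mul, Matrix.mul_assoc]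
  simp only [h, born_conj, Matrix.mul_one]
  rw [← born_sum_left]
  refine born_mono ?_ (S.posSemidef_projected P k b j)
  have h2 : ∑ l, ((1 : Matrix (Fin (S.m₁ (k + 1))) (Fin (S.m₁ (k + 1))) ℂ) ⊗ₖ
      (S.test₂ k).K b l)ᴴ * ((1 : Matrix (Fin (S.m₁ (k + 1))) (Fin (S.m₁ (k + 1))) ℂ) ⊗ₖ
      (S.test₂ k).K b l) = 1 ⊗ₖ ((S.test₂ k).toPOVM.E b) := by
    simp only [Matrix.conjTranspose_kronecker, ← Matrix.mul_kronecker_mul,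
      Matrix.conjTranspose_one, Matrix.one_mul, Instrument.toPOVM, kronecker_sum]
  rw [h2, ← kronecker_sub]
  exact Matrix.PosSemidef.one.kronecker ((S.test₂ k).toPOVM.posSemidef_one_sub b)

lemma sum_deficit_le (k : ℕ) :
    ∑ t, S.deficit P k ((S.coin₂ k).E t) ≤ S.survive P k - S.survive P (k + 1) := by
  have h : ∑ t, S.deficit P k ((S.coin₂ k).E t) =
      ∑ t, S.announceWeight P k t - ∑ t, ∑ b, S.accepted P k b ((S.coin₂ k).E t) := by
    rw [← Finset.sum_sub_distrib]; rfl
  rw [h, sum_announceWeight, Finset.sum_comm]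
  simp only [sum_accepted]
  linarith [S.survive_succ_le P k]

lemma deficit_nonneg (k : ℕ) (t : Fin N × Fin (S.R k)) :
    0 ≤ S.deficit P k ((S.coin₂ k).E t) :=
  (S.deficit_nonneg_and_born_proj_le P k t.1 0 one_pos ((S.coin₂ k).pos t)).1

lemma announceTossWeight_le (k : ℕ) (t : Fin N × Fin (S.R k)) (c : Fin 2) {ε : ℝ} (hε : 0 < ε) :
    S.announceTossWeight P k t c ≤
      (1 + ε) * (∑ b, P.prob (b t.1) c * S.accepted P k b ((S.coin₂ k).E t)) +
      (1 + 1 / ε) * S.deficit P k ((S.coin₂ k).E t) :=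
  (S.deficit_nonneg_and_born_proj_le P k t.1 c hε ((S.coin₂ k).pos t)).2

lemma survive_antitone : Antitone (S.survive P) :=
  antitone_nat_of_succ_le fun k => sub_nonneg.1 <|
    (Finset.sum_nonneg fun t _ => S.deficit_nonneg P k t).trans (S.sum_deficit_le P k)

lemma survive_le_one (k : ℕ) : S.survive P k ≤ 1 :=
  (S.survive_antitone P (Nat.zero_le k)).trans_eq (S.survive_zero P)

end BobStrategy

/-! ### Summation over the rounds: security against Bob -/

/-- The probability that an honest Alice tests rounds `0, …, k - 1` and trusts Bob in round `k`, if
no test ends the protocol. -/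
noncomputable def trustAt (M k : ℕ) : ℝ := trust M * (1 - trust M) ^ k

lemma trustAt_nonneg (M k : ℕ) : 0 ≤ trustAt M k :=
  mul_nonneg (trust_pos M).le (pow_nonneg (sub_nonneg.2 (trust_le_one M)) k)

lemma trustAt_le (M k : ℕ) : trustAt M k ≤ trust M :=
  mul_le_of_le_one_right (trust_pos M).le
    (pow_le_one₀ (sub_nonneg.2 (trust_le_one M)) (sub_le_self 1 (trust_pos M).le))

lemma summable_trustAt_mul (M : ℕ) {a : ℕ → ℝ} (h0 : ∀ k, 0 ≤ a k) {C : ℝ} (h1 : ∀ k, a k ≤ C) :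
    Summable fun k => trustAt M k * a k :=
  Summable.of_nonneg_of_le (fun k => mul_nonneg (trustAt_nonneg M k) (h0 k))
    (fun k => mul_le_mul_of_nonneg_left (h1 k) (trustAt_nonneg M k))
    ((hasSum_trust M).summable.mul_right C)

lemma tsum_trustAt_mul_le (M : ℕ) {a : ℕ → ℝ} (h0 : ∀ k, 0 ≤ a k) {C : ℝ} (h1 : ∀ k, a k ≤ C) :
    ∑' k, trustAt M k * a k ≤ C := by
  refine ((summable_trustAt_mul M h0 h1).tsum_le_tsum
    (fun k => mul_le_mul_of_nonneg_left (h1 k) (trustAt_nonneg M k))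
    ((hasSum_trust M).summable.mul_right C)).trans_eq ?_
  rw [tsum_mul_right]
  exact (congrArg (· * C) (hasSum_trust M).tsum_eq).trans (one_mul C)

namespace BobStrategy

variable {N : ℕ} (S : BobStrategy N) (P : Params)

lemma survive_sub_nonneg (k : ℕ) : 0 ≤ S.survive P k - S.survive P (k + 1) :=
  sub_nonneg.2 (S.survive_antitone P (Nat.le_succ k))

lemma summable_toss (M : ℕ) : Summable fun k => trustAt M k * S.survive P k :=
  summable_trustAt_mul M (S.survive_nonneg P) (S.survive_le_one P)

lemma summable_fail (M : ℕ) :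
    Summable fun k => trustAt M k * (S.survive P k - S.survive P (k + 1)) :=
  summable_trustAt_mul M (S.survive_sub_nonneg P)
    (fun k => (sub_le_self _ (S.survive_nonneg P _)).trans (S.survive_le_one P k))

/-- A batch that would fail the test is trusted only if Alice trusts Bob in precisely that
round. -/
lemma tsum_fail_le (M : ℕ) :
    ∑' k, trustAt M k * (S.survive P k - S.survive P (k + 1)) ≤ trust M := by
  refine Real.tsum_le_of_sum_range_le
    (fun k => mul_nonneg (trustAt_nonneg M k) (S.survive_sub_nonneg P k)) fun n => ?_
  refine (Finset.sum_le_sum fun k _ => mul_le_mul_of_nonneg_right (trustAt_le M k)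
    (S.survive_sub_nonneg P k)).trans ?_
  rw [← Finset.mul_sum, Finset.sum_range_sub']
  refine mul_le_of_le_one_right (trust_pos M).le ?_
  linarith [S.survive_nonneg P n, S.survive_zero P]

/-- Unless Bob is caught, the coin toss stage is eventually reached. -/
lemma caughtProb_eq (M : ℕ) : S.caughtProb P M = 1 - S.tossProb P M := by
  have hs := S.summable_toss P M
  have hs' : Summable fun k => (1 - trust M) ^ k * S.survive P k := by
    have := hs.mul_left (trust M)⁻¹
    refine this.congr fun k => ?_
    rw [trustAt, mul_assoc, inv_mul_cancel_left₀ (trust_pos M).ne']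
  have hs1 : Summable fun k => (1 - trust M) ^ (k + 1) * S.survive P (k + 1) :=
    (summable_nat_add_iff (f := fun k => (1 - trust M) ^ k * S.survive P k) 1).2 hs'
  have h0 := hs'.tsum_eq_zero_add
  rw [pow_zero, one_mul, survive_zero] at h0
  have h1 : S.caughtProb P M = (1 - trust M) * ∑' k, (1 - trust M) ^ k * S.survive P k -
      ∑' k, (1 - trust M) ^ (k + 1) * S.survive P (k + 1) := by
    rw [← tsum_mul_left, ← (hs'.mul_left _).tsum_sub hs1, caughtProb]
    refine tsum_congr fun k => ?_
    rw [pow_succ]; ring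
  have h2 : S.tossProb P M = trust M * ∑' k, (1 - trust M) ^ k * S.survive P k := by
    rw [← tsum_mul_left, tossProb]
    exact tsum_congr fun k => by ring
  rw [h1, h2]; linarith

/-- If in some round `B₂` finds, with a certain weight, positions with an illegitimate bias, then
the test would fail in this round with a weight that is comparable. -/
lemma sum_cheat_le (k : ℕ) (c : Fin 2) {δ : ℝ} (hδ : 0 < δ) :
    ∑ t, (if (P.top c + δ) * S.announceWeight P k t ≤ S.announceTossWeight P k t c
      then S.announceWeight P k t else 0) ≤
    2 / δ * (1 + 2 / δ) * (S.survive P k - S.survive P (k + 1)) := by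
  have hC : 0 ≤ 2 / δ * (1 + 2 / δ) := by positivity
  refine le_trans ?_ (mul_le_mul_of_nonneg_left (S.sum_deficit_le P k) hC)
  rw [Finset.mul_sum]
  refine Finset.sum_le_sum fun t _ => ?_
  have hd := S.deficit_nonneg P k t
  split_ifs with h
  · have hw := S.announceWeight_nonneg P k t
    -- with `ε = δ / 2`, the factor `1 + ε` uses up only half of the advantage `δ`, as `top c ≤ 1`
    have h1 := h.trans (S.announceTossWeight_le P k t c (half_pos hδ))
    have hA : ∑ b, P.prob (b t.1) c * S.accepted P k b ((S.coin₂ k).E t) ≤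
        P.top c * S.announceWeight P k t := by
      have : ∑ b, S.accepted P k b ((S.coin₂ k).E t) ≤ S.announceWeight P k t := by
        rw [deficit] at hd; exact sub_nonneg.1 hd
      refine le_trans ?_ (mul_le_mul_of_nonneg_left this (P.top_nonneg c))
      rw [Finset.mul_sum]
      exact Finset.sum_le_sum fun b _ => mul_le_mul_of_nonneg_right (P.prob_le_top _ _)
        (S.accepted_nonneg P k b ((S.coin₂ k).pos t))
    have h2 : (1 + δ / 2) * (P.top c * S.announceWeight P k t) ≤
        (P.top c + δ / 2) * S.announceWeight P k t := by
      have : δ / 2 * (P.top c * S.announceWeight P k t) ≤ δ / 2 * S.announceWeight P k t :=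
        mul_le_mul_of_nonneg_left (mul_le_of_le_one_left hw (P.top_le_one c)) (half_pos hδ).le
      linarith
    have h3 := mul_le_mul_of_nonneg_left hA (by linarith : 0 ≤ 1 + δ / 2)
    have h4 : δ / 2 * S.announceWeight P k t ≤
        (1 + 2 / δ) * S.deficit P k ((S.coin₂ k).E t) := by
      rw [one_div_div] at h1; linarith
    have h5 := mul_le_mul_of_nonneg_left h4 (by positivity : 0 ≤ 2 / δ)
    calc S.announceWeight P k t = 2 / δ * (δ / 2 * S.announceWeight P k t) := by field_simp
      _ ≤ _ := by rw [mul_assoc]; exact h5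
  · exact mul_nonneg hC hd

lemma cheatProb_le (M : ℕ) (c : Fin 2) {δ : ℝ} (hδ : 0 < δ) :
    S.cheatProb P M c δ ≤ 2 / δ * (1 + 2 / δ) * trust M := by
  have hC : 0 ≤ 2 / δ * (1 + 2 / δ) := by positivity
  have h0 : ∀ k, 0 ≤ ∑ t, (if (P.top c + δ) * S.announceWeight P k t ≤
      S.announceTossWeight P k t c then S.announceWeight P k t else 0) := fun k =>
    Finset.sum_nonneg fun t _ => by
      split_ifs
      exacts [S.announceWeight_nonneg P k t, le_rfl]
  have h1 : ∀ k, trustAt M k * ∑ t, (if (P.top c + δ) * S.announceWeight P k t ≤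
      S.announceTossWeight P k t c then S.announceWeight P k t else 0) ≤
      2 / δ * (1 + 2 / δ) * (trustAt M k * (S.survive P k - S.survive P (k + 1))) := fun k => by
    rw [mul_left_comm]
    exact mul_le_mul_of_nonneg_left (S.sum_cheat_le P k c hδ) (trustAt_nonneg M k)
  have hs := (S.summable_fail P M).mul_left (2 / δ * (1 + 2 / δ))
  have hs' := Summable.of_nonneg_of_le (fun k => mul_nonneg (trustAt_nonneg M k) (h0 k)) h1 hs
  refine (hs'.tsum_le_tsum h1 hs).trans ?_
  rw [tsum_mul_left]
  exact mul_le_mul_of_nonneg_left (S.tsum_fail_le P M) hC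

/-- The weight, in round `k`, of the event that the projection succeeds for the string `b` in `B₁`'s
reply to a test, and that the state `|ψ_{b_i}⟩` at the position `i` that `B₂` would announce in a
coin toss gives the outcome `c`. -/
noncomputable def legit (k : ℕ) (c : Fin 2) : ℝ :=
  ∑ t, ∑ b, P.prob (b t.1) c * S.accepted P k b ((S.coin₂ k).E t)

lemma legit_nonneg (k : ℕ) (c : Fin 2) : 0 ≤ S.legit P k c :=
  Finset.sum_nonneg fun t _ => Finset.sum_nonneg fun b _ =>
    mul_nonneg (P.prob_pos _ _).le (S.accepted_nonneg P k b ((S.coin₂ k).pos t))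

lemma sum_legit (k : ℕ) :
    S.legit P k 0 + S.legit P k 1 = ∑ t, ∑ b, S.accepted P k b ((S.coin₂ k).E t) := by
  simp only [legit, ← Finset.sum_add_distrib, ← add_mul]
  refine Finset.sum_congr rfl fun t _ => Finset.sum_congr rfl fun b _ => ?_
  rw [← Fin.sum_univ_two (f := fun c => P.prob (b t.1) c), P.sum_prob, one_mul]

lemma sum_legit_le_one (k : ℕ) : S.legit P k 0 + S.legit P k 1 ≤ 1 := by
  have h : ∑ t, ∑ b, S.accepted P k b ((S.coin₂ k).E t) ≤ ∑ t, S.announceWeight P k t :=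
    Finset.sum_le_sum fun t _ => by
      have := S.deficit_nonneg P k t
      rw [deficit] at this
      exact sub_nonneg.1 this
  rw [sum_legit]
  exact h.trans ((S.sum_announceWeight P k).trans_le (S.survive_le_one P k))

lemma legit_le_one (k : ℕ) (c : Fin 2) : S.legit P k c ≤ 1 := by
  have h := S.sum_legit_le_one P k
  have h0 := S.legit_nonneg P k 0
  have h1 := S.legit_nonneg P k 1
  fin_cases c
  · simp only [Fin.zero_eta]; linarith
  · simp only [Fin.mk_one]; linarith

lemma legit_zero_mem (k : ℕ) : S.legit P k 0 ∈
    Set.Icc (P.pmin * (S.legit P k 0 + S.legit P k 1))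
      (P.pmax * (S.legit P k 0 + S.legit P k 1)) := by
  rw [sum_legit]
  constructor
  all_goals
    simp only [legit, Finset.mul_sum]
    refine Finset.sum_le_sum fun t _ => Finset.sum_le_sum fun b _ =>
      mul_le_mul_of_nonneg_right ?_ (S.accepted_nonneg P k b ((S.coin₂ k).pos t))
  exacts [(P.prob_zero_mem _).1, (P.prob_zero_mem _).2]

lemma out_nonneg (k : ℕ) (i : Fin N) (r : Fin (S.R k)) (c : Fin 2) :
    0 ≤ born (proj i c ⊗ₖ ((S.coin₁ k).E i ⊗ₖ (S.coin₂ k).E (i, r))) (S.state P k) :=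
  born_nonneg ((posSemidef_proj i c).kronecker
    (((S.coin₁ k).pos i).kronecker ((S.coin₂ k).pos (i, r)))) (S.posSemidef_state P k)

lemma sum_out_le (k : ℕ) (c : Fin 2) {ε : ℝ} (hε : 0 < ε) :
    ∑ i : Fin N, ∑ r : Fin (S.R k),
      born (proj i c ⊗ₖ ((S.coin₁ k).E i ⊗ₖ (S.coin₂ k).E (i, r))) (S.state P k) ≤
    (1 + ε) * S.legit P k c + (1 + 1 / ε) * (S.survive P k - S.survive P (k + 1)) := by
  have h1 : ∑ i : Fin N, ∑ r : Fin (S.R k),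
      born (proj i c ⊗ₖ ((S.coin₁ k).E i ⊗ₖ (S.coin₂ k).E (i, r))) (S.state P k) ≤
      ∑ t, S.announceTossWeight P k t c := by
    rw [Fintype.sum_prod_type]
    refine Finset.sum_le_sum fun i _ => Finset.sum_le_sum fun r _ => ?_
    refine born_mono ?_ (S.posSemidef_state P k)
    rw [← kronecker_sub, ← sub_kronecker]
    exact (posSemidef_proj i c).kronecker (((S.coin₁ k).posSemidef_one_sub i).kronecker
      ((S.coin₂ k).pos (i, r)))
  refine h1.trans ((Finset.sum_le_sum fun t _ => S.announceTossWeight_le P k t c hε).trans ?_)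
  rw [Finset.sum_add_distrib, ← Finset.mul_sum, ← Finset.mul_sum]
  exact add_le_add le_rfl (mul_le_mul_of_nonneg_left (S.sum_deficit_le P k) (by positivity))

lemma outProb_le (M : ℕ) (c : Fin 2) :
    S.outProb P M c ≤ ∑' k, trustAt M k * S.legit P k c + (trust M + 2 * √(trust M)) := by
  have ht := trust_pos M
  -- `ε = √(trust M)` balances the relative error `ε` against the failure term `trust M / ε`
  have hε : 0 < √(trust M) := Real.sqrt_pos.2 ht
  have hl := summable_trustAt_mul M (fun k => S.legit_nonneg P k c) (fun k => S.legit_le_one P k c)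
  have hs := (hl.mul_left (1 + √(trust M))).add
    ((S.summable_fail P M).mul_left (1 + 1 / √(trust M)))
  have h1 : ∀ k, trustAt M k * ∑ i : Fin N, ∑ r : Fin (S.R k),
      born (proj i c ⊗ₖ ((S.coin₁ k).E i ⊗ₖ (S.coin₂ k).E (i, r))) (S.state P k) ≤
      (1 + √(trust M)) * (trustAt M k * S.legit P k c) +
      (1 + 1 / √(trust M)) * (trustAt M k * (S.survive P k - S.survive P (k + 1))) := fun k => by
    refine (mul_le_mul_of_nonneg_left (S.sum_out_le P k c hε) (trustAt_nonneg M k)).trans_eq ?_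
    ring
  have h0 : ∀ k, 0 ≤ trustAt M k * ∑ i : Fin N, ∑ r : Fin (S.R k),
      born (proj i c ⊗ₖ ((S.coin₁ k).E i ⊗ₖ (S.coin₂ k).E (i, r))) (S.state P k) := fun k =>
    mul_nonneg (trustAt_nonneg M k) (Finset.sum_nonneg fun i _ => Finset.sum_nonneg fun r _ =>
      S.out_nonneg P k i r c)
  refine ((Summable.of_nonneg_of_le h0 h1 hs).tsum_le_tsum h1 hs).trans ?_
  rw [(hl.mul_left _).tsum_add ((S.summable_fail P M).mul_left _), tsum_mul_left, tsum_mul_left]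
  have h2 : ∑' k, trustAt M k * S.legit P k c ≤ 1 :=
    tsum_trustAt_mul_le M (fun k => S.legit_nonneg P k c) (fun k => S.legit_le_one P k c)
  have h3 := mul_le_mul_of_nonneg_left (S.tsum_fail_le P M)
    (by positivity : 0 ≤ 1 + 1 / √(trust M))
  have h4 : (1 + 1 / √(trust M)) * trust M = trust M + √(trust M) := by
    rw [add_mul, one_mul, one_div, inv_mul_eq_div, Real.div_sqrt]
  have h5 := mul_le_mul_of_nonneg_left h2 hε.le
  linarith

end BobStrategy

lemma exists_caughtProb_ge {δ δ' κ : ℝ} (hδ : 0 < δ) (hδ' : 0 < δ') (hκ : 0 < κ) :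
    ∃ M₀ : ℕ, ∀ M ≥ M₀, ∀ (P : Params) (N : ℕ) (S : BobStrategy N) (c : Fin 2),
      δ' * S.tossProb P M ≤ S.cheatProb P M c δ → 1 - κ ≤ S.caughtProb P M := by
  have hlim := (tendsto_trust.const_mul (2 / δ * (1 + 2 / δ))).eventually_lt_const
    (u := δ' * κ) (by rw [mul_zero]; positivity)
  obtain ⟨M₀, hM₀⟩ := Filter.eventually_atTop.1 hlim
  refine ⟨M₀, fun M hM P N S c h => ?_⟩
  have h1 := (h.trans (S.cheatProb_le P M c hδ)).trans (hM₀ M hM).le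
  have h2 := le_of_mul_le_mul_left h1 hδ'
  rw [S.caughtProb_eq]; linarith

/-- Up to a small error, Bob's outcome probabilities are dominated by those of a legitimate bias. To
define it, the weight that is missing because the protocol may not be completed is treated as if
`|ψ_0⟩` were used for the coin toss. -/
lemma exists_outProb_le (P : Params) (N M : ℕ) (S : BobStrategy N) :
    ∃ p ∈ Set.Icc P.pmin P.pmax,
      S.outProb P M 0 ≤ p + (trust M + 2 * √(trust M)) ∧
      S.outProb P M 1 ≤ 1 - p + (trust M + 2 * √(trust M)) := by
  have hl := fun c => summable_trustAt_mul M (fun k => S.legit_nonneg P k c)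
    (fun k => S.legit_le_one P k c)
  set L := fun c => ∑' k, trustAt M k * S.legit P k c with hL
  have hsum : ∑' k, trustAt M k * (S.legit P k 0 + S.legit P k 1) = L 0 + L 1 := by
    rw [hL, ← (hl 0).tsum_add (hl 1)]
    exact tsum_congr fun k => mul_add _ _ _
  have hs : Summable fun k => trustAt M k * (S.legit P k 0 + S.legit P k 1) :=
    ((hl 0).add (hl 1)).congr fun k => (mul_add _ _ _).symm
  have hμ : L 0 + L 1 ≤ 1 := by
    rw [← hsum]
    exact tsum_trustAt_mul_le M (fun k => add_nonneg (S.legit_nonneg P k 0) (S.legit_nonneg P k 1))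
      (S.sum_legit_le_one P)
  have hlow : P.pmin * (L 0 + L 1) ≤ L 0 := by
    rw [← hsum, ← tsum_mul_left]
    refine (hs.mul_left _).tsum_le_tsum (fun k => ?_) (hl 0)
    rw [mul_left_comm]
    exact mul_le_mul_of_nonneg_left (S.legit_zero_mem P k).1 (trustAt_nonneg M k)
  have hup : L 0 ≤ P.pmax * (L 0 + L 1) := by
    rw [← hsum, ← tsum_mul_left]
    refine (hl 0).tsum_le_tsum (fun k => ?_) (hs.mul_left _)
    rw [mul_left_comm]
    exact mul_le_mul_of_nonneg_left (S.legit_zero_mem P k).2 (trustAt_nonneg M k)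
  have hmm : P.pmin ≤ P.pmax := P.lt.le
  have hmax0 : 0 ≤ P.pmax := sq_nonneg _
  have hmax1 : P.pmax ≤ 1 := by simpa [Params.top] using P.top_le_one 0
  have h1 := mul_le_mul_of_nonneg_right hmm (sub_nonneg.2 hμ)
  have h2 := mul_le_of_le_one_left (sub_nonneg.2 hμ) hmax1
  have h3 := mul_nonneg hmax0 (sub_nonneg.2 hμ)
  refine ⟨L 0 + P.pmax * (1 - (L 0 + L 1)), ⟨?_, ?_⟩, ?_, ?_⟩
  · linarith
  · linarith
  · linarith [S.outProb_le P M 0]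
  · linarith [S.outProb_le P M 1]

lemma tendsto_bob_error :
    Filter.Tendsto (fun M => trust M + 2 * √(trust M)) Filter.atTop (nhds 0) := by
  have h := tendsto_trust.add (((Real.continuous_sqrt.tendsto 0).comp tendsto_trust).const_mul 2)
  simpa using h

/-! ### Honest Bob: the outcome of the coin toss -/

/-- The isometry that adjoins the batch `b`, so that `withBatch P b τ` is its conjugation
of `τ`. -/
noncomputable def batchKet (P : Params) {N : ℕ} (m₁ m₂ : ℕ) (b : Qubits N) :
    Matrix (((Fin m₁ × Qubits N) × Fin m₂) × Qubits N) (Fin m₁ × Fin m₂) ℂ :=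
  Matrix.of fun s a => if a = (s.1.1.1, s.1.2) then P.batch b (s.2, s.1.1.2) else 0

lemma withBatch_eq (P : Params) {N m₁ m₂ : ℕ} (b : Qubits N)
    (τ : Matrix (Fin m₁ × Fin m₂) (Fin m₁ × Fin m₂) ℂ) :
    withBatch P b τ = batchKet P m₁ m₂ b * τ * (batchKet P m₁ m₂ b)ᴴ := by
  ext s s'
  simp only [withBatch, Matrix.of_apply, Matrix.mul_apply, batchKet, Matrix.conjTranspose_apply,
    ite_mul, zero_mul, apply_ite star, star_zero, mul_ite, mul_zero, Finset.sum_ite_eq',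
    Finset.mem_univ, if_true]
  ring

lemma posSemidef_withBatch (P : Params) {N m₁ m₂ : ℕ} (b : Qubits N)
    {τ : Matrix (Fin m₁ × Fin m₂) (Fin m₁ × Fin m₂) ℂ} (hτ : τ.PosSemidef) :
    (withBatch P b τ).PosSemidef := by
  rw [withBatch_eq]; exact hτ.mul_mul_conjTranspose_same _

lemma mul_batchKet (P : Params) {N m₁ m₂ : ℕ} (b : Qubits N) (Y : Matrix (Fin m₂) (Fin m₂) ℂ) :
    (((1 : Matrix (Fin m₁ × Qubits N) (Fin m₁ × Qubits N) ℂ) ⊗ₖ Y) ⊗ₖ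
      (1 : Matrix (Qubits N) (Qubits N) ℂ)) * batchKet P m₁ m₂ b =
    batchKet P m₁ m₂ b * ((1 : Matrix (Fin m₁) (Fin m₁) ℂ) ⊗ₖ Y) := by
  ext ⟨⟨⟨e₁, y⟩, e₂⟩, x⟩ ⟨a₁, a₂⟩
  rw [Matrix.mul_apply, Matrix.mul_apply]
  simp only [batchKet, Matrix.of_apply, Matrix.kroneckerMap_apply,
    Matrix.one_apply, Fintype.sum_prod_type, Prod.mk.injEq, ite_and, ite_mul, mul_ite, zero_mul,
    mul_zero, one_mul, mul_one]
  rw [Finset.sum_eq_single e₁ (fun e _ he => by simp [Ne.symm he]) (by simp),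
    Finset.sum_eq_single y (fun e _ he => by simp [Ne.symm he]) (by simp),
    Finset.sum_eq_single a₂ (fun e _ he => by simp [Ne.symm he]) (by simp),
    Finset.sum_eq_single x (fun e _ he => by simp [Ne.symm he]) (by simp),
    Finset.sum_eq_single e₁ (fun e _ he => by simp [he]) (by simp),
    Finset.sum_eq_single e₂ (fun e _ he => by simp [he]) (by simp)]
  by_cases h : a₁ = e₁
  · subst h; simp [mul_comm]
  · simp [h, Ne.symm h]

/-- In the state `|Ψ_b⟩`, whatever `B₁` measures in the computational basis has the distribution
`batchProb b`, independently of the memory of `A₂`. -/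
lemma batchKet_sandwich (P : Params) {N m₁ m₂ : ℕ} (b : Qubits N) (D : Qubits N → ℝ)
    (Y : Matrix (Fin m₂) (Fin m₂) ℂ) :
    (batchKet P m₁ m₂ b)ᴴ * (((1 : Matrix (Fin m₁ × Qubits N) (Fin m₁ × Qubits N) ℂ) ⊗ₖ Y) ⊗ₖ
      Matrix.diagonal (fun x => (D x : ℂ))) * batchKet P m₁ m₂ b =
    ((∑ x, D x * P.batchProb b x : ℝ) : ℂ) • ((1 : Matrix (Fin m₁) (Fin m₁) ℂ) ⊗ₖ Y) := by
  have h1 : ((1 : Matrix (Fin m₁ × Qubits N) (Fin m₁ × Qubits N) ℂ) ⊗ₖ Y) ⊗ₖ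
      Matrix.diagonal (fun x => (D x : ℂ)) =
      (((1 : Matrix (Fin m₁ × Qubits N) (Fin m₁ × Qubits N) ℂ) ⊗ₖ
        (1 : Matrix (Fin m₂) (Fin m₂) ℂ)) ⊗ₖ Matrix.diagonal (fun x => (D x : ℂ))) *
      (((1 : Matrix (Fin m₁ × Qubits N) (Fin m₁ × Qubits N) ℂ) ⊗ₖ Y) ⊗ₖ
        (1 : Matrix (Qubits N) (Qubits N) ℂ)) := by
    simp only [← Matrix.mul_kronecker_mul, Matrix.one_mul, Matrix.mul_one]
  have h2 : (batchKet P m₁ m₂ b)ᴴ * (((1 : Matrix (Fin m₁ × Qubits N) (Fin m₁ × Qubits N) ℂ) ⊗ₖ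
        (1 : Matrix (Fin m₂) (Fin m₂) ℂ)) ⊗ₖ Matrix.diagonal (fun x => (D x : ℂ))) *
      batchKet P m₁ m₂ b =
      ((∑ x, D x * P.batchProb b x : ℝ) : ℂ) • (1 : Matrix (Fin m₁ × Fin m₂) _ ℂ) := by
    rw [Matrix.one_kronecker_one, ← Matrix.diagonal_one, Matrix.diagonal_kronecker_diagonal]
    ext ⟨a₁, a₂⟩ ⟨c₁, c₂⟩
    rw [Matrix.mul_apply]
    simp only [Matrix.mul_diagonal, Matrix.conjTranspose_apply, batchKet, Matrix.of_apply,
      Fintype.sum_prod_type, Prod.mk.injEq, ite_and, ite_mul, mul_ite, zero_mul, mul_zero, one_mul,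
      apply_ite star, star_zero, Matrix.smul_apply, Matrix.one_apply, smul_eq_mul, P.star_batch]
    rw [Finset.sum_eq_single c₁ (fun e _ he => by simp [Ne.symm he]) (by simp)]
    by_cases hc : a₁ = c₁
    · by_cases hc' : a₂ = c₂
      · subst hc hc'
        simp only [if_true, mul_one]
        push_cast
        refine Finset.sum_congr rfl fun x _ => ?_
        rw [Finset.sum_eq_single a₂ (fun e _ he => by simp [Ne.symm he]) (by simp),
          Finset.sum_eq_single x (fun y _ hy => by simp [P.batch_eq, hy]) (by simp)]
        simp only [if_true]
        rw [mul_right_comm, P.batch_self_mul, mul_comm]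
      · simp only [hc', if_false, ite_self]
        refine Finset.sum_eq_zero fun x _ => Finset.sum_eq_zero fun e _ =>
          Finset.sum_eq_zero fun y _ => ?_
        by_cases h3 : c₂ = e
        · subst h3; simp [hc']
        · simp [h3]
    · simp [hc]
  rw [h1, Matrix.mul_assoc, Matrix.mul_assoc, mul_batchKet, ← Matrix.mul_assoc, ← Matrix.mul_assoc,
    h2, Matrix.smul_mul, Matrix.one_mul]

lemma born_one_kronecker_withBatch (P : Params) {N m₁ m₂ : ℕ} (b : Qubits N) (D : Qubits N → ℝ)
    (Y : Matrix (Fin m₂) (Fin m₂) ℂ) (τ : Matrix (Fin m₁ × Fin m₂) (Fin m₁ × Fin m₂) ℂ) :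
    born (((1 : Matrix (Fin m₁ × Qubits N) (Fin m₁ × Qubits N) ℂ) ⊗ₖ Y) ⊗ₖ
      Matrix.diagonal (fun x => (D x : ℂ))) (withBatch P b τ) =
    (∑ x, D x * P.batchProb b x) * born ((1 : Matrix (Fin m₁) (Fin m₁) ℂ) ⊗ₖ Y) τ := by
  rw [withBatch_eq, born_conj, batchKet_sandwich, born_smul_left]

lemma batch_update (P : Params) {N : ℕ} (b x y : Qubits N) (i : Fin N) (w w' : Fin 2) :
    (P.amp w' (x i) : ℂ) * P.batch (Function.update b i w) (x, y) =
      (P.amp w (x i) : ℂ) * P.batch (Function.update b i w') (x, y) := by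
  have h : ∀ v, ∏ j, P.amp (Function.update b i v j) (x j) =
      P.amp v (x i) * ∏ j ∈ Finset.univ.erase i, P.amp (b j) (x j) := by
    intro v
    rw [← Finset.mul_prod_erase _ _ (Finset.mem_univ i), Function.update_self]
    congr 1
    refine Finset.prod_congr rfl fun j hj => ?_
    rw [Function.update_of_ne (Finset.ne_of_mem_erase hj)]
  simp only [P.batch_eq, h]
  split_ifs
  · push_cast; ring
  · simp

/-- Once `B₁` has found the outcome `c` on the `i`-th qubit, the state no longer depends on which
of the two states was at that position, except for its weight. -/
lemma born_proj_withBatch_update (P : Params) {N m₁ m₂ : ℕ} (b : Qubits N) (i : Fin N)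
    (c w w' : Fin 2)
    (G : Matrix ((Fin m₁ × Qubits N) × Fin m₂) ((Fin m₁ × Qubits N) × Fin m₂) ℂ)
    (τ : Matrix (Fin m₁ × Fin m₂) (Fin m₁ × Fin m₂) ℂ) :
    P.prob w' c * born (G ⊗ₖ proj i c) (withBatch P (Function.update b i w) τ) =
      P.prob w c * born (G ⊗ₖ proj i c) (withBatch P (Function.update b i w') τ) := by
  have h : (P.prob w' c : ℂ) * ((G ⊗ₖ proj i c) * withBatch P (Function.update b i w) τ).trace =
      (P.prob w c : ℂ) * ((G ⊗ₖ proj i c) * withBatch P (Function.update b i w') τ).trace := by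
    simp only [Matrix.trace, Matrix.diag_apply, Matrix.mul_apply, Finset.mul_sum]
    refine Finset.sum_congr rfl fun s _ => Finset.sum_congr rfl fun s' _ => ?_
    simp only [Matrix.kroneckerMap_apply, proj, Matrix.diagonal_apply, withBatch, Matrix.of_apply,
      P.star_batch]
    by_cases hs : s.2 = s'.2
    · by_cases hc : s'.2 i = c
      · have h1 := batch_update P b s'.2 s.1.1.2 i w w'
        have h2 := batch_update P b s'.2 s'.1.1.2 i w w'
        rw [hs, if_pos rfl, if_pos hc]
        rw [hc] at h1 h2
        have h3 := congrArg₂ (· * ·) h1 h2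
        simp only [← P.amp_sq, Complex.ofReal_pow]
        linear_combination (G s.1 s'.1 * τ (s'.1.1.1, s'.1.2) (s.1.1.1, s.1.2)) * h3
      · rw [hs, if_pos rfl, if_neg hc]; ring
    · rw [if_neg hs]; ring
  simpa [born, Complex.re_ofReal_mul] using congrArg Complex.re h

namespace AliceStrategy

variable {N : ℕ} (S : AliceStrategy N) (P : Params)

/-- The effect `F` after the announcement of `z` by both agents, pulled back to the time before
it. -/
noncomputable def pullback (k : ℕ) (z : Fin 2)
    (F : Matrix (Fin (S.n₁ k) × Fin (S.n₂ k)) (Fin (S.n₁ k) × Fin (S.n₂ k)) ℂ) :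
    Matrix ((Fin (S.m₁ k) × Qubits N) × Fin (S.m₂ k))
      ((Fin (S.m₁ k) × Qubits N) × Fin (S.m₂ k)) ℂ :=
  ∑ j, ∑ l, ((S.bit₁ k).K z j ⊗ₖ (S.bit₂ k).K z l)ᴴ * F * ((S.bit₁ k).K z j ⊗ₖ (S.bit₂ k).K z l)

lemma born_afterBits (k : ℕ) (b : Qubits N) (z : Fin 2)
    (τ : Matrix (Fin (S.m₁ k) × Fin (S.m₂ k)) (Fin (S.m₁ k) × Fin (S.m₂ k)) ℂ)
    (F : Matrix (Fin (S.n₁ k) × Fin (S.n₂ k)) (Fin (S.n₁ k) × Fin (S.n₂ k)) ℂ)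
    (D : Matrix (Qubits N) (Qubits N) ℂ) :
    born (F ⊗ₖ D) (S.afterBits P k b z τ) = born (S.pullback k z F ⊗ₖ D) (withBatch P b τ) := by
  simp only [afterBits, born_sum_right, pullback, sum_kronecker, born_sum_left]
  refine Finset.sum_congr rfl fun j _ => Finset.sum_congr rfl fun l _ => ?_
  rw [born_conj, Matrix.conjTranspose_kronecker, ← Matrix.mul_kronecker_mul,
    ← Matrix.mul_kronecker_mul, Matrix.conjTranspose_one, Matrix.one_mul, Matrix.mul_one]

lemma pullback_one (k : ℕ) (z : Fin 2) :
    S.pullback k z 1 = (S.bit₁ k).toPOVM.E z ⊗ₖ (S.bit₂ k).toPOVM.E z := by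
  simp only [pullback, Instrument.toPOVM, Matrix.mul_one, Matrix.conjTranspose_kronecker,
    ← Matrix.mul_kronecker_mul, sum_kronecker, kronecker_sum]
  exact Finset.sum_comm

lemma posSemidef_afterBits (k : ℕ) (b : Qubits N) (z : Fin 2)
    {τ : Matrix (Fin (S.m₁ k) × Fin (S.m₂ k)) (Fin (S.m₁ k) × Fin (S.m₂ k)) ℂ}
    (hτ : τ.PosSemidef) : (S.afterBits P k b z τ).PosSemidef :=
  Matrix.posSemidef_sum _ fun _ _ => Matrix.posSemidef_sum _ fun _ _ =>
    (posSemidef_withBatch P b hτ).mul_mul_conjTranspose_same _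

lemma posSemidef_memory (k : ℕ) : (S.memory P k).PosSemidef := by
  induction k with
  | zero => exact S.start_density.1
  | succ k ih =>
    rw [memory]
    refine Matrix.PosSemidef.smul (Matrix.posSemidef_sum _ fun b _ =>
      Instrument.posSemidef_channel _ (S.posSemidef_afterBits P k b 1 ih)) ?_
    rw [inv_nonneg]; exact Nat.cast_nonneg _

/-- The probability that round `k` takes place and `A₂` announces `z` in it. -/
noncomputable def announce (k : ℕ) (z : Fin 2) : ℝ :=
  born ((1 : Matrix (Fin (S.m₁ k)) (Fin (S.m₁ k)) ℂ) ⊗ₖ (S.bit₂ k).toPOVM.E z) (S.memory P k)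

lemma announce_nonneg (k : ℕ) (z : Fin 2) : 0 ≤ S.announce P k z :=
  born_nonneg (Matrix.PosSemidef.one.kronecker ((S.bit₂ k).toPOVM.pos z)) (S.posSemidef_memory P k)

lemma sum_announce (k : ℕ) :
    S.announce P k 0 + S.announce P k 1 = (S.memory P k).trace.re := by
  rw [← Fin.sum_univ_two (f := S.announce P k), ← born_one]
  simp only [announce]
  rw [← born_sum_left, ← kronecker_sum, (S.bit₂ k).toPOVM.total, Matrix.one_kronecker_one]

/-- As `A₂` announces her bit independently of the batch, the outcome found by `B₁` is independent
of it; the bit of `A₁` can only lower the probability that both announce `z`. -/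
lemma born_afterBits_le (k : ℕ) (b : Qubits N) (z : Fin 2) {D : Qubits N → ℝ} (hD : ∀ x, 0 ≤ D x) :
    born ((1 : Matrix (Fin (S.n₁ k) × Fin (S.n₂ k)) _ ℂ) ⊗ₖ
      Matrix.diagonal (fun x => (D x : ℂ))) (S.afterBits P k b z (S.memory P k)) ≤
    (∑ x, D x * P.batchProb b x) * S.announce P k z := by
  rw [born_afterBits, pullback_one, announce, ← born_one_kronecker_withBatch]
  refine born_mono ?_ (posSemidef_withBatch P b (S.posSemidef_memory P k))
  rw [← sub_kronecker, ← sub_kronecker]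
  refine (((S.bit₁ k).toPOVM.posSemidef_one_sub z).kronecker
    ((S.bit₂ k).toPOVM.pos z)).kronecker ?_
  rw [Matrix.posSemidef_diagonal_iff]
  intro x; simpa using hD x

lemma sum_born_final_le (k : ℕ) (b : Qubits N) (i : Fin N) (c : Fin 2) :
    ∑ y, born ((S.final k i).E y ⊗ₖ proj i c) (S.afterBits P k b 0 (S.memory P k)) ≤
      P.prob (b i) c * S.announce P k 0 := by
  rw [← born_sum_left, ← sum_kronecker, (S.final k i).total, proj_eq]
  refine (S.born_afterBits_le P k b 0 fun x => by split_ifs <;> simp).trans_eq ?_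
  simp [← P.sum_batchProb_apply]

lemma born_final_nonneg (k : ℕ) (b : Qubits N) (i : Fin N) (c : Fin 2) (y : Fin (S.R k)) :
    0 ≤ born ((S.final k i).E y ⊗ₖ proj i c) (S.afterBits P k b 0 (S.memory P k)) :=
  born_nonneg (((S.final k i).pos y).kronecker (posSemidef_proj i c))
    (S.posSemidef_afterBits P k b 0 (S.posSemidef_memory P k))

/-- Another round takes place only if `A₂` announces `1`. -/
lemma trace_memory_succ_le (hN : 2 ≤ N) (k : ℕ) :
    (S.memory P (k + 1)).trace.re ≤ S.announce P k 1 := by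
  have hcard : 0 < ((goodBatches N).card : ℝ) := by exact_mod_cast goodBatches_card_pos hN
  have h : ∀ b, ((S.next k b).channel (S.afterBits P k b 1 (S.memory P k))).trace.re ≤
      S.announce P k 1 := by
    intro b
    rw [Instrument.trace_channel, ← born_one, ← Matrix.one_kronecker_one, ← Matrix.diagonal_one]
    have := S.born_afterBits_le P k b 1 (D := fun _ => 1) fun _ => zero_le_one
    simpa [P.sum_batchProb] using this
  have e : (S.memory P (k + 1)).trace.re = ((goodBatches N).card : ℝ)⁻¹ * ∑ b ∈ goodBatches N,
      ((S.next k b).channel (S.afterBits P k b 1 (S.memory P k))).trace.re := by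
    rw [memory, Matrix.trace_smul, Matrix.trace_sum, smul_eq_mul, ← Complex.ofReal_natCast,
      ← Complex.ofReal_inv, Complex.re_ofReal_mul, Complex.re_sum]
  rw [e, inv_mul_le_iff₀ hcard]
  refine (Finset.sum_le_sum fun b _ => h b).trans_eq ?_
  rw [Finset.sum_const, nsmul_eq_mul]

lemma sum_range_announce_le (hN : 2 ≤ N) (n : ℕ) :
    ∑ k ∈ Finset.range n, S.announce P k 0 ≤ 1 := by
  have h : ∑ k ∈ Finset.range n, S.announce P k 0 ≤ 1 - (S.memory P n).trace.re := by
    induction n with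
    | zero => simp [memory, S.start_density.2]
    | succ n ih =>
      rw [Finset.sum_range_succ]
      have h1 := S.trace_memory_succ_le P hN n
      have h2 := S.sum_announce P n
      linarith
  have := (Complex.le_def.1 (S.posSemidef_memory P n).trace_nonneg).1
  rw [Complex.zero_re] at this
  linarith

lemma summable_announce (hN : 2 ≤ N) : Summable fun k => S.announce P k 0 :=
  summable_of_sum_range_le (S.announce_nonneg P · 0) (S.sum_range_announce_le P hN)

lemma tsum_announce_le (hN : 2 ≤ N) : ∑' k, S.announce P k 0 ≤ 1 :=
  Real.tsum_le_of_sum_range_le (S.announce_nonneg P · 0) (S.sum_range_announce_le P hN)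

lemma viewProb_nonneg (w : Fin 2) (k : ℕ) (c : Fin 2) (y : Fin (S.R k)) :
    0 ≤ S.viewProb P w k c y :=
  mul_nonneg (by positivity) (Finset.sum_nonneg fun b _ => mul_nonneg (by positivity)
    (Finset.sum_nonneg fun i _ => S.born_final_nonneg P k b i c y))

lemma sum_viewProb_le (hN : 2 ≤ N) (w : Fin 2) (k : ℕ) (c : Fin 2) :
    ∑ y, S.viewProb P w k c y ≤ P.prob w c * S.announce P k 0 := by
  simp only [viewProb, ← Finset.mul_sum]
  rw [← average_const hN w (P.prob w c * S.announce P k 0), Finset.sum_comm]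
  refine mul_le_mul_of_nonneg_left (Finset.sum_le_sum fun b _ => ?_) (by positivity)
  rw [← Finset.mul_sum, Finset.sum_comm]
  refine mul_le_mul_of_nonneg_left (Finset.sum_le_sum fun i hi => ?_) (by positivity)
  rw [← (Finset.mem_filter.1 hi).2]
  exact S.sum_born_final_le P k b i c

lemma summable_sum_viewProb (hN : 2 ≤ N) (w c : Fin 2) :
    Summable fun k => ∑ y, S.viewProb P w k c y :=
  Summable.of_nonneg_of_le (fun k => Finset.sum_nonneg fun y _ => S.viewProb_nonneg P w k c y)
    (fun k => S.sum_viewProb_le P hN w k c) ((S.summable_announce P hN).mul_left _)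

lemma outProb_le (hN : 2 ≤ N) (w c : Fin 2) : S.outProb P w c ≤ P.prob w c := by
  refine ((S.summable_sum_viewProb P hN w c).tsum_le_tsum
    (fun k => S.sum_viewProb_le P hN w k c) ((S.summable_announce P hN).mul_left _)).trans ?_
  rw [tsum_mul_left]
  exact mul_le_of_le_one_right (P.prob_pos w c).le (S.tsum_announce_le P hN)

end AliceStrategy

/-! ### The distribution of the chosen position and of the rest of the batch -/

/-- Exchange of the two states at the position `i` of a batch. -/
def flipAt {N : ℕ} (i : Fin N) : Equiv.Perm (Qubits N) :=
  Function.Involutive.toPerm (fun b => Function.update b i (b i + 1)) fun b => by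
    have h : ∀ x : Fin 2, x + 1 + 1 = x := by decide
    simp [h]

lemma flipAt_apply {N : ℕ} (i : Fin N) (b : Qubits N) :
    flipAt i b = Function.update b i (b i + 1) := rfl

lemma add_one_eq_iff (x w : Fin 2) : x + 1 = w ↔ ¬x = w := by
  revert x w; decide

lemma two_mul_sum_ite_eq {N : ℕ} (i : Fin N) (w : Fin 2) {h : Qubits N → ℝ}
    (hh : ∀ b, h (flipAt i b) = h b) : 2 * ∑ b, (if b i = w then h b else 0) = ∑ b, h b := by
  have h1 : ∑ b, (if b i = w then h b else 0) = ∑ b, (if b i = w then 0 else h b) := by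
    rw [← Equiv.sum_comp (flipAt i)]
    refine Finset.sum_congr rfl fun b _ => ?_
    rw [hh, flipAt_apply, Function.update_self]
    simp only [add_one_eq_iff, ite_not]
  rw [two_mul]
  nth_rewrite 2 [h1]
  rw [← Finset.sum_add_distrib]
  refine Finset.sum_congr rfl fun b _ => ?_
  split_ifs <;> simp

lemma card_candidates {N : ℕ} (b : Qubits N) (w : Fin 2) :
    ((candidates b w).card : ℝ) = ∑ j, if b j = w then (1 : ℝ) else 0 := by
  simp [candidates]

/-- The variance of a sum of independent signs. -/
lemma sum_sq_candidates {N : ℕ} (w : Fin 2) :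
    ∑ b : Qubits N, ((N : ℝ) - 2 * ((candidates b w).card : ℝ)) ^ 2 = (N : ℝ) * (2 : ℝ) ^ N := by
  let s : Fin N → Qubits N → ℝ := fun j b => 1 - 2 * if b j = w then 1 else 0
  have hs : ∀ b, (N : ℝ) - 2 * ((candidates b w).card : ℝ) = ∑ j, s j b := by
    intro b
    simp only [s, Finset.sum_sub_distrib, ← Finset.mul_sum, card_candidates]
    simp
  have hsq : ∀ j b, s j b * s j b = 1 := by
    intro j b; simp only [s]; split_ifs <;> norm_num
  have hflip : ∀ j b, s j (flipAt j b) = -s j b := by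
    intro j b
    simp only [s, flipAt_apply, Function.update_self, add_one_eq_iff, ite_not]
    split_ifs <;> norm_num
  have hflip' : ∀ j l b, l ≠ j → s l (flipAt j b) = s l b := by
    intro j l b hl
    simp only [s, flipAt_apply, Function.update_of_ne hl]
  have horth : ∀ j l, ∑ b, s j b * s l b = if j = l then 2 ^ N else 0 := by
    intro j l
    split_ifs with h
    · subst h; simp [hsq]
    · have h1 : ∑ b, s j b * s l b = -∑ b, s j b * s l b := by
        nth_rewrite 1 [← Equiv.sum_comp (flipAt j)]
        simp only [hflip, hflip' j l _ (Ne.symm h), neg_mul, Finset.sum_neg_distrib]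
      linarith
  simp only [hs, pow_two, Finset.sum_mul_sum]
  rw [Finset.sum_comm]
  refine (Finset.sum_congr rfl fun j _ => Finset.sum_comm).trans ?_
  simp [horth]

lemma sum_abs_candidates_le {N : ℕ} (hN : 2 ≤ N) (w : Fin 2) :
    ∑ b : Qubits N, |1 - 2 / (N : ℝ) * ((candidates b w).card : ℝ)| ≤ 2 ^ N / √N := by
  have hN0 : (0 : ℝ) < N := by exact_mod_cast (by omega : 0 < N)
  have h1 : ∀ b : Qubits N, |1 - 2 / (N : ℝ) * ((candidates b w).card : ℝ)| =
      (N : ℝ)⁻¹ * |(N : ℝ) - 2 * ((candidates b w).card : ℝ)| := by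
    intro b
    nth_rewrite 1 [← abs_of_pos (inv_pos.2 hN0)]
    rw [← abs_mul]
    congr 1
    field_simp
  have h2 : ∑ b : Qubits N, |(N : ℝ) - 2 * ((candidates b w).card : ℝ)| ≤ √N * 2 ^ N := by
    refine (sq_le_sq₀ (Finset.sum_nonneg fun _ _ => abs_nonneg _) (by positivity)).1 ?_
    refine sq_sum_le_card_mul_sum_sq.trans_eq ?_
    simp only [sq_abs, sum_sq_candidates, mul_pow, Real.sq_sqrt hN0.le]
    simp
    ring
  simp only [h1]
  rw [← Finset.mul_sum]
  refine (mul_le_mul_of_nonneg_left h2 (inv_pos.2 hN0).le).trans_eq ?_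
  have : √(N : ℝ) * √N = N := Real.mul_self_sqrt hN0.le
  field_simp
  rw [pow_two, this]

/-- A bound for the `ℓ¹` distance between the joint distribution of the chosen position and the rest
of the batch, given Bob's input, and a weight function that does not depend on the input. -/
noncomputable def deviation (N : ℕ) : ℝ := 2 / √N + 4 * (1 / 2) ^ N

lemma tendsto_deviation : Filter.Tendsto deviation Filter.atTop (nhds 0) := by
  have h1 : Filter.Tendsto (fun N : ℕ => 2 / √(N : ℝ)) Filter.atTop (nhds 0) :=
    (Real.tendsto_sqrt_atTop.comp tendsto_natCast_atTop_atTop).const_div_atTop 2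
  have h2 := (tendsto_pow_atTop_nhds_zero_of_lt_one (by norm_num : (0 : ℝ) ≤ 1 / 2)
    (by norm_num)).const_mul 4
  have h3 := h1.add h2
  rw [mul_zero, add_zero] at h3
  exact h3

lemma deviation_nonneg (N : ℕ) : 0 ≤ deviation N := by unfold deviation; positivity

/-- Compared to choosing each position with the state `w`, in each of the batches, with the same
weight, Bob's choice of position is only slightly biased. -/
lemma sum_weight_deviation_le {N : ℕ} (hN : 2 ≤ N) (w : Fin 2) :
    ((goodBatches N).card : ℝ)⁻¹ * ∑ b : Qubits N, ((candidates b w).card : ℝ) *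
      |(if b ∈ goodBatches N then ((candidates b w).card : ℝ)⁻¹ else 0) - 2 / N| ≤
    deviation N := by
  have hN0 : (0 : ℝ) < N := by exact_mod_cast (by omega : 0 < N)
  have hp : (4 : ℝ) ≤ 2 ^ N := by
    have := pow_le_pow_right₀ (one_le_two (α := ℝ)) hN
    norm_num at this ⊢; exact this
  have hcard : ((goodBatches N).card : ℝ) = 2 ^ N - 2 := by
    rw [goodBatches_card hN, Nat.cast_sub]
    · simp
    · exact_mod_cast (by linarith : (2 : ℝ) ≤ 2 ^ N)
  have h1 : ∀ b : Qubits N, ((candidates b w).card : ℝ) *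
      |(if b ∈ goodBatches N then ((candidates b w).card : ℝ)⁻¹ else 0) - 2 / N| ≤
      |1 - 2 / (N : ℝ) * ((candidates b w).card : ℝ)| + if b ∈ goodBatches N then 0 else 1 := by
    intro b
    have hc : (0 : ℝ) ≤ (candidates b w).card := by positivity
    nth_rewrite 1 [← abs_of_nonneg hc]
    rw [← abs_mul]
    split_ifs with hb
    · have : ((candidates b w).card : ℝ) ≠ 0 := by
        exact_mod_cast (candidates_card_pos hb w).ne'
      rw [mul_sub, mul_inv_cancel₀ this, mul_comm _ (2 / (N : ℝ)), add_zero]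
    · rw [zero_sub, mul_neg, abs_neg, mul_comm]
      have := abs_sub (1 : ℝ) (1 - 2 / (N : ℝ) * ((candidates b w).card : ℝ))
      rw [sub_sub_cancel, abs_one] at this
      linarith
  have h2 : ∑ b : Qubits N, (if b ∈ goodBatches N then (0 : ℝ) else 1) = 2 := by
    have h3 : ∑ b : Qubits N, (if b ∈ goodBatches N then (1 : ℝ) else 0) +
        ∑ b : Qubits N, (if b ∈ goodBatches N then (0 : ℝ) else 1) = 2 ^ N := by
      rw [← Finset.sum_add_distrib, Finset.sum_congr rfl (g := fun _ => (1 : ℝ))]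
      · simp
      · intro b _; split_ifs <;> simp
    rw [Finset.sum_ite_mem] at h3
    simp only [Finset.univ_inter, Finset.sum_const, nsmul_eq_mul, mul_one, hcard] at h3
    linarith
  have h4 := (Finset.sum_le_sum (s := Finset.univ) fun b _ => h1 b).trans_eq
    Finset.sum_add_distrib
  rw [h2] at h4
  have h5 := sum_abs_candidates_le hN w
  rw [hcard, inv_mul_le_iff₀ (by linarith)]
  have h6 : 2 ^ N * deviation N = 2 * (2 ^ N / √N) + 4 := by
    rw [deviation, mul_add, mul_left_comm, ← mul_pow]; norm_num; ring
  have h7 : 2 ^ N * deviation N ≤ 2 * ((2 ^ N - 2) * deviation N) := by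
    have := mul_le_mul_of_nonneg_right (by linarith : (2 : ℝ) ^ N ≤ 2 * (2 ^ N - 2))
      (deviation_nonneg N)
    linarith
  linarith

namespace AliceStrategy

variable {N : ℕ} (S : AliceStrategy N) (P : Params)

/-- The probability, if the position `i` of the batch `b` is used in round `k`, that both bits are
`0` and Alice's final result is `y`, given that `B₁` finds the outcome `c` on his qubit. -/
noncomputable def viewGiven (k : ℕ) (c : Fin 2) (y : Fin (S.R k)) (i : Fin N) (b : Qubits N) : ℝ :=
  born ((S.final k i).E y ⊗ₖ proj i c) (S.afterBits P k b 0 (S.memory P k)) / P.prob (b i) c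

lemma viewGiven_nonneg (k : ℕ) (c : Fin 2) (y : Fin (S.R k)) (i : Fin N) (b : Qubits N) :
    0 ≤ S.viewGiven P k c y i b :=
  div_nonneg (S.born_final_nonneg P k b i c y) (P.prob_pos _ _).le

lemma sum_viewGiven_le (k : ℕ) (c : Fin 2) (i : Fin N) (b : Qubits N) :
    ∑ y, S.viewGiven P k c y i b ≤ S.announce P k 0 := by
  simp only [viewGiven]
  rw [← Finset.sum_div, div_le_iff₀ (P.prob_pos _ _), mul_comm]
  exact S.sum_born_final_le P k b i c

/-- Given the outcome of the coin toss, the state that was used for it does not matter. -/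
lemma viewGiven_flipAt (k : ℕ) (c : Fin 2) (y : Fin (S.R k)) (i : Fin N) (b : Qubits N) :
    S.viewGiven P k c y i (flipAt i b) = S.viewGiven P k c y i b := by
  have h := born_proj_withBatch_update P b i c (b i + 1) (b i)
    (S.pullback k 0 ((S.final k i).E y)) (S.memory P k)
  rw [Function.update_eq_self] at h
  simp only [viewGiven, born_afterBits, flipAt_apply, Function.update_self]
  rw [div_eq_div_iff (P.prob_pos _ _).ne' (P.prob_pos _ _).ne', mul_comm, h, mul_comm]

/-- The average of `viewGiven` over the batches, and over the positions that Bob uses if his input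
is `w`. -/
noncomputable def condView (w : Fin 2) (k : ℕ) (c : Fin 2) (y : Fin (S.R k)) : ℝ :=
  ((goodBatches N).card : ℝ)⁻¹ * ∑ b ∈ goodBatches N,
    ((candidates b w).card : ℝ)⁻¹ * ∑ i ∈ candidates b w, S.viewGiven P k c y i b

lemma viewProb_eq (w : Fin 2) (k : ℕ) (c : Fin 2) (y : Fin (S.R k)) :
    S.viewProb P w k c y = P.prob w c * S.condView P w k c y := by
  rw [viewProb, condView, mul_left_comm]
  congr 1
  rw [Finset.mul_sum]
  refine Finset.sum_congr rfl fun b _ => ?_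
  rw [mul_left_comm]
  congr 1
  rw [Finset.mul_sum]
  refine Finset.sum_congr rfl fun i hi => ?_
  rw [viewGiven, (Finset.mem_filter.1 hi).2, mul_div_cancel₀ _ (P.prob_pos w c).ne']

lemma condView_nonneg (w : Fin 2) (k : ℕ) (c : Fin 2) (y : Fin (S.R k)) :
    0 ≤ S.condView P w k c y :=
  mul_nonneg (by positivity) (Finset.sum_nonneg fun b _ => mul_nonneg (by positivity)
    (Finset.sum_nonneg fun i _ => S.viewGiven_nonneg P k c y i b))

/-- A variant of `condView` which does not depend on Bob's input: all positions of all batches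
get the same weight. -/
noncomputable def idealView (k : ℕ) (c : Fin 2) (y : Fin (S.R k)) : ℝ :=
  ((goodBatches N).card : ℝ)⁻¹ * ((N : ℝ)⁻¹ * ∑ i, ∑ b, S.viewGiven P k c y i b)

lemma sum_candidates {N : ℕ} (b : Qubits N) (w : Fin 2) (h : Fin N → ℝ) :
    ∑ i ∈ candidates b w, h i = ∑ i, if b i = w then h i else 0 :=
  Finset.sum_filter _ _

lemma idealView_eq (w : Fin 2) (k : ℕ) (c : Fin 2) (y : Fin (S.R k)) :
    S.idealView P k c y = ((goodBatches N).card : ℝ)⁻¹ * ∑ b, ∑ i ∈ candidates b w,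
      2 / N * S.viewGiven P k c y i b := by
  rw [idealView]
  congr 1
  simp only [sum_candidates, ← two_mul_sum_ite_eq _ w (S.viewGiven_flipAt P k c y _)]
  rw [Finset.sum_comm, Finset.mul_sum]
  refine Finset.sum_congr rfl fun i _ => ?_
  rw [Finset.mul_sum, Finset.mul_sum]
  refine Finset.sum_congr rfl fun b _ => ?_
  split_ifs
  · ring
  · simp

lemma sum_abs_condView_sub_idealView_le (hN : 2 ≤ N) (w : Fin 2) (k : ℕ) (c : Fin 2) :
    ∑ y, |S.condView P w k c y - S.idealView P k c y| ≤ deviation N * S.announce P k 0 := by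
  let v : Qubits N → ℝ := fun b =>
    (if b ∈ goodBatches N then ((candidates b w).card : ℝ)⁻¹ else 0) - 2 / N
  have hcond : ∀ y, S.condView P w k c y = ((goodBatches N).card : ℝ)⁻¹ * ∑ b,
      ∑ i ∈ candidates b w, (if b ∈ goodBatches N then ((candidates b w).card : ℝ)⁻¹ else 0) *
        S.viewGiven P k c y i b := by
    intro y
    rw [condView]
    congr 1
    rw [← Finset.sum_subset (Finset.subset_univ (goodBatches N))]
    · refine Finset.sum_congr rfl fun b hb => ?_
      rw [Finset.mul_sum, if_pos hb]
    · intro b _ hb; simp [hb]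
  have h1 : ∀ y, |S.condView P w k c y - S.idealView P k c y| ≤
      ((goodBatches N).card : ℝ)⁻¹ * ∑ b, ∑ i ∈ candidates b w,
        |v b| * S.viewGiven P k c y i b := by
    intro y
    rw [hcond, idealView_eq S P w, ← mul_sub, abs_mul,
      abs_of_nonneg (by positivity : 0 ≤ ((goodBatches N).card : ℝ)⁻¹)]
    refine mul_le_mul_of_nonneg_left ?_ (by positivity)
    simp only [← Finset.sum_sub_distrib, ← sub_mul]
    refine (Finset.abs_sum_le_sum_abs _ _).trans (Finset.sum_le_sum fun b _ =>
      (Finset.abs_sum_le_sum_abs _ _).trans_eq (Finset.sum_congr rfl fun i _ => ?_))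
    rw [abs_mul, abs_of_nonneg (S.viewGiven_nonneg P k c y i b)]
  refine (Finset.sum_le_sum fun y _ => h1 y).trans ?_
  refine le_trans ?_ (mul_le_mul_of_nonneg_right (sum_weight_deviation_le hN w)
    (S.announce_nonneg P k 0))
  rw [← Finset.mul_sum, mul_assoc, Finset.sum_comm, Finset.sum_mul]
  refine mul_le_mul_of_nonneg_left (Finset.sum_le_sum fun b _ => ?_) (by positivity)
  rw [Finset.sum_comm, mul_assoc, ← nsmul_eq_mul]
  refine Finset.sum_le_card_nsmul _ _ _ fun i _ => ?_
  rw [← Finset.mul_sum]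
  exact mul_le_mul_of_nonneg_left (S.sum_viewGiven_le P k c i b) (abs_nonneg _)

lemma sum_abs_condView_sub_le (hN : 2 ≤ N) (k : ℕ) (c : Fin 2) :
    ∑ y, |S.condView P 0 k c y - S.condView P 1 k c y| ≤
      2 * deviation N * S.announce P k 0 := by
  have h : ∀ y, |S.condView P 0 k c y - S.condView P 1 k c y| ≤
      |S.condView P 0 k c y - S.idealView P k c y| +
      |S.condView P 1 k c y - S.idealView P k c y| := fun y => by
    rw [abs_sub_comm (S.condView P 1 k c y)]
    exact abs_sub_le _ _ _
  refine (Finset.sum_le_sum fun y _ => h y).trans ?_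
  rw [Finset.sum_add_distrib]
  linarith [S.sum_abs_condView_sub_idealView_le P hN 0 k c,
    S.sum_abs_condView_sub_idealView_le P hN 1 k c]

end AliceStrategy

/-! ### Continuity of the entropy -/

lemma negMulLog_add_add_le {x a y : ℝ} (hx : 0 ≤ x) (ha : 0 ≤ a) (hy : 0 ≤ y) :
    Real.negMulLog x + Real.negMulLog (x + a + y) ≤
      Real.negMulLog (x + a) + Real.negMulLog (x + y) := by
  rcases (add_nonneg ha hy).eq_or_lt with h | h
  · have ha0 : a = 0 := by linarith
    have hy0 : y = 0 := by linarith
    simp [ha0, hy0]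
  · have h0 : x ∈ Set.Ici (0 : ℝ) := hx
    have h1 : x + a + y ∈ Set.Ici (0 : ℝ) := by simp only [Set.mem_Ici]; linarith
    have hsum : a / (a + y) + y / (a + y) = 1 := by rw [← add_div, div_self h.ne']
    have hsum' : y / (a + y) + a / (a + y) = 1 := by rw [add_comm, hsum]
    have e1 := Real.concaveOn_negMulLog.2 h0 h1 (div_nonneg ha h.le) (div_nonneg hy h.le) hsum
    have e2 := Real.concaveOn_negMulLog.2 h0 h1 (div_nonneg hy h.le) (div_nonneg ha h.le) hsum'
    simp only [smul_eq_mul] at e1 e2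
    have p1 : a / (a + y) * x + y / (a + y) * (x + a + y) = x + y := by field_simp; ring
    have p2 : y / (a + y) * x + a / (a + y) * (x + a + y) = x + a := by field_simp; ring
    rw [p1] at e1
    rw [p2] at e2
    have e3 := add_le_add e1 e2
    have e4 : a / (a + y) * Real.negMulLog x + y / (a + y) * Real.negMulLog (x + a + y) +
        (y / (a + y) * Real.negMulLog x + a / (a + y) * Real.negMulLog (x + a + y)) =
        (a / (a + y) + y / (a + y)) * (Real.negMulLog x + Real.negMulLog (x + a + y)) := by ring
    rw [e4, hsum, one_mul] at e3
    linarith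

lemma negMulLog_add_le {a x : ℝ} (ha : 0 ≤ a) (hx : 0 ≤ x) :
    Real.negMulLog (a + x) ≤ Real.negMulLog a + Real.negMulLog x := by
  simpa using negMulLog_add_add_le le_rfl ha hx

lemma negMulLog_le_add {T X : ℝ} (hT : 0 ≤ T) (hX : 0 ≤ X) (h : T + X ≤ 1) :
    Real.negMulLog T ≤ Real.negMulLog (T + X) + X := by
  rcases hT.eq_or_lt with rfl | hT
  · rw [zero_add] at h ⊢
    rw [Real.negMulLog_zero]
    exact add_nonneg (Real.negMulLog_nonneg hX h) hX
  · have h1 : Real.log (T + X) ≤ 0 := Real.log_nonpos (by linarith) h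
    have h2 : Real.log (T + X) - Real.log T ≤ X / T := by
      rw [← Real.log_div (by linarith) hT.ne']
      refine (Real.log_le_sub_one_of_pos (by positivity)).trans_eq ?_
      field_simp; ring
    have h3 := mul_le_mul_of_nonneg_left h2 hT.le
    rw [mul_div_cancel₀ _ hT.ne'] at h3
    have h4 := mul_nonneg hX (neg_nonneg.2 h1)
    simp only [Real.negMulLog]
    linarith

lemma negMulLog_le_two_sqrt {x : ℝ} (hx : 0 ≤ x) : Real.negMulLog x ≤ 2 * √x := by
  have h := Real.negMulLog_le_one_sub_self (Real.sqrt_nonneg x)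
  have h1 : Real.negMulLog x = 2 * (√x * Real.negMulLog √x) := by
    nth_rewrite 1 [← Real.mul_self_sqrt hx]
    rw [Real.negMulLog_mul]; ring
  have h2 := mul_le_mul_of_nonneg_left h (Real.sqrt_nonneg x)
  have h3 := mul_self_nonneg √x
  rw [h1]
  linarith

/-- `weightedEntropy`, in terms of the function `-x log x`. -/
lemma weightedEntropy_eq {a b : ℝ} (ha : 0 ≤ a) (hb : 0 ≤ b) : weightedEntropy a b =
    (Real.negMulLog a + Real.negMulLog b - Real.negMulLog (a + b)) / Real.log 2 := by
  have h : ∀ x y : ℝ, 0 ≤ x → 0 ≤ y → x * Real.logb 2 (x / (x + y)) =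
      (x * Real.log x - x * Real.log (x + y)) / Real.log 2 := by
    intro x y hx hy
    rcases hx.eq_or_lt with rfl | hx
    · simp
    · rw [Real.logb, Real.log_div hx.ne' (by linarith)]; ring
  rw [weightedEntropy, h a b ha hb, add_comm a b, h b a hb ha]
  simp only [Real.negMulLog]
  ring

lemma weightedEntropy_mul {t : ℝ} (ht : 0 ≤ t) (a b : ℝ) :
    weightedEntropy (t * a) (t * b) = t * weightedEntropy a b := by
  rcases ht.eq_or_lt with rfl | ht
  · simp [weightedEntropy]
  · rw [weightedEntropy, weightedEntropy, ← mul_add, mul_div_mul_left _ _ ht.ne',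
      mul_div_mul_left _ _ ht.ne']
    ring

lemma weightedEntropy_mono {a b a' b' : ℝ} (ha : 0 ≤ a) (hb : 0 ≤ b) (ha' : a ≤ a')
    (hb' : b ≤ b') : weightedEntropy a b ≤ weightedEntropy a' b' := by
  have h1 := negMulLog_add_add_le ha (sub_nonneg.2 ha') hb
  have h2 := negMulLog_add_add_le hb (sub_nonneg.2 hb') (ha.trans ha')
  rw [weightedEntropy_eq ha hb, weightedEntropy_eq (ha.trans ha') (hb.trans hb')]
  refine div_le_div_of_nonneg_right ?_ (Real.log_nonneg one_le_two)
  rw [add_sub_cancel] at h1 h2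
  rw [add_comm b' a', add_comm b a'] at h2
  linarith

lemma weightedEntropy_nonneg {a b : ℝ} (ha : 0 ≤ a) (hb : 0 ≤ b) : 0 ≤ weightedEntropy a b := by
  simpa [weightedEntropy] using weightedEntropy_mono le_rfl le_rfl ha hb

lemma weightedEntropy_le {a b : ℝ} (ha : 0 ≤ a) (hb : 0 ≤ b) :
    weightedEntropy a b ≤ (a + b) / Real.log 2 := by
  have h : ∀ x y : ℝ, 0 ≤ x → 0 ≤ y → -(x * Real.logb 2 (x / (x + y))) ≤ y / Real.log 2 := by
    intro x y hx hy
    rcases (add_nonneg hx hy).eq_or_lt with h0 | h0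
    · rw [← h0, div_zero, Real.logb_zero, mul_zero, neg_zero]
      exact div_nonneg hy (Real.log_nonneg one_le_two)
    · have h1 := mul_le_mul_of_nonneg_left
        (Real.negMulLog_le_one_sub_self (div_nonneg hx h0.le)) h0.le
      have h2 : (x + y) * (1 - x / (x + y)) = y := by field_simp; ring
      have h3 : (x + y) * Real.negMulLog (x / (x + y)) = -(x * Real.log (x / (x + y))) := by
        rw [Real.negMulLog]; field_simp
      rw [h2, h3] at h1
      rw [Real.logb, ← mul_div_assoc, ← neg_div]
      exact div_le_div_of_nonneg_right h1 (Real.log_nonneg one_le_two)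
  have h1 := h a b ha hb
  have h2 := h b a hb ha
  rw [add_comm b a] at h2
  rw [weightedEntropy, add_div]
  linarith

lemma weightedEntropy_add_le {a b x y d : ℝ} (ha : 0 ≤ a) (hb : 0 ≤ b) (hx : 0 ≤ x) (hy : 0 ≤ y)
    (hxd : x ≤ d) (hyd : y ≤ d) (h : a + x + (b + y) ≤ 1) :
    weightedEntropy (a + x) (b + y) ≤ weightedEntropy a b + (4 * √d + 2 * d) / Real.log 2 := by
  rw [weightedEntropy_eq ha hb, weightedEntropy_eq (add_nonneg ha hx) (add_nonneg hb hy), ← add_div]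
  refine div_le_div_of_nonneg_right ?_ (Real.log_nonneg one_le_two)
  have h1 := negMulLog_add_le ha hx
  have h2 := negMulLog_add_le hb hy
  have h3 := negMulLog_le_add (add_nonneg ha hb) (add_nonneg hx hy) (by linarith)
  rw [add_add_add_comm a b x y] at h3
  have h4 := (negMulLog_le_two_sqrt hx).trans
    (mul_le_mul_of_nonneg_left (Real.sqrt_le_sqrt hxd) zero_le_two)
  have h5 := (negMulLog_le_two_sqrt hy).trans
    (mul_le_mul_of_nonneg_left (Real.sqrt_le_sqrt hyd) zero_le_two)
  linarith

/-! ### Alice's information on Bob's input -/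

namespace AliceStrategy

variable {N : ℕ} (S : AliceStrategy N) (P : Params)

/-- The part of Alice's view, given the outcome of the coin toss, that is common to both inputs. -/
noncomputable def commonView (k : ℕ) (c : Fin 2) (y : Fin (S.R k)) : ℝ :=
  min (S.condView P 0 k c y) (S.condView P 1 k c y)

lemma commonView_nonneg (k : ℕ) (c : Fin 2) (y : Fin (S.R k)) : 0 ≤ S.commonView P k c y :=
  le_min (S.condView_nonneg P 0 k c y) (S.condView_nonneg P 1 k c y)

lemma commonView_le (w : Fin 2) (k : ℕ) (c : Fin 2) (y : Fin (S.R k)) :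
    S.commonView P k c y ≤ S.condView P w k c y := by
  fin_cases w
  exacts [min_le_left _ _, min_le_right _ _]

lemma condView_sub_commonView_le (w : Fin 2) (k : ℕ) (c : Fin 2) (y : Fin (S.R k)) :
    S.condView P w k c y - S.commonView P k c y ≤
      |S.condView P 0 k c y - S.condView P 1 k c y| := by
  unfold commonView
  have h1 := le_abs_self (S.condView P 0 k c y - S.condView P 1 k c y)
  have h2 := neg_abs_le (S.condView P 0 k c y - S.condView P 1 k c y)
  fin_cases w <;>
    rcases min_cases (S.condView P 0 k c y) (S.condView P 1 k c y) with ⟨h, _⟩ | ⟨h, _⟩ <;>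
    rw [h] <;> simp only [Fin.zero_eta, Fin.mk_one] <;> linarith [abs_nonneg
      (S.condView P 0 k c y - S.condView P 1 k c y)]

lemma sum_condView_le (hN : 2 ≤ N) (w : Fin 2) (k : ℕ) (c : Fin 2) :
    ∑ y, S.condView P w k c y ≤ S.announce P k 0 := by
  have h := S.sum_viewProb_le P hN w k c
  simp only [viewProb_eq, ← Finset.mul_sum] at h
  exact le_of_mul_le_mul_left h (P.prob_pos w c)

lemma summable_condView (hN : 2 ≤ N) (w c : Fin 2) :
    Summable fun k => ∑ y, S.condView P w k c y :=
  Summable.of_nonneg_of_le (fun k => Finset.sum_nonneg fun y _ => S.condView_nonneg P w k c y)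
    (fun k => S.sum_condView_le P hN w k c) (S.summable_announce P hN)

lemma tsum_condView_le (hN : 2 ≤ N) (w c : Fin 2) :
    ∑' k, ∑ y, S.condView P w k c y ≤ 1 :=
  ((S.summable_condView P hN w c).tsum_le_tsum (fun k => S.sum_condView_le P hN w k c)
    (S.summable_announce P hN)).trans (S.tsum_announce_le P hN)

lemma outProb_eq (w c : Fin 2) :
    S.outProb P w c = P.prob w c * ∑' k, ∑ y, S.condView P w k c y := by
  simp only [outProb, viewProb_eq, ← Finset.mul_sum, tsum_mul_left]

lemma summable_commonView (hN : 2 ≤ N) (c : Fin 2) :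
    Summable fun k => ∑ y, S.commonView P k c y :=
  Summable.of_nonneg_of_le (fun k => Finset.sum_nonneg fun y _ => S.commonView_nonneg P k c y)
    (fun k => Finset.sum_le_sum fun y _ => S.commonView_le P 0 k c y)
    (S.summable_condView P hN 0 c)

lemma tsum_condView_sub_mem (hN : 2 ≤ N) (w c : Fin 2) :
    ∑' k, ∑ y, S.condView P w k c y - ∑' k, ∑ y, S.commonView P k c y ∈
      Set.Icc 0 (2 * deviation N) := by
  have h1 := S.summable_condView P hN w c
  have h2 := S.summable_commonView P hN c
  rw [← h1.tsum_sub h2]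
  constructor
  · exact tsum_nonneg fun k => sub_nonneg.2
      (Finset.sum_le_sum fun y _ => S.commonView_le P w k c y)
  · have h3 := (S.summable_announce P hN).mul_left (2 * deviation N)
    refine ((h1.sub h2).tsum_le_tsum (fun k => ?_) h3).trans ?_
    · rw [← Finset.sum_sub_distrib]
      exact (Finset.sum_le_sum fun y _ => S.condView_sub_commonView_le P w k c y).trans
        (S.sum_abs_condView_sub_le P hN k c)
    · rw [tsum_mul_left]
      exact mul_le_of_le_one_right (mul_nonneg zero_le_two (deviation_nonneg N))
        (S.tsum_announce_le P hN)

/-- The bound on Alice's information, in bits. -/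
noncomputable def infoBound (N : ℕ) : ℝ :=
  2 * ((4 * √(2 * deviation N) + 2 * (2 * deviation N)) / Real.log 2)

lemma tendsto_infoBound : Filter.Tendsto infoBound Filter.atTop (nhds 0) := by
  have h := tendsto_deviation.const_mul 2
  rw [mul_zero] at h
  have h1 := (((((Real.continuous_sqrt.tendsto 0).comp h).const_mul 4).add
    (h.const_mul 2)).div_const (Real.log 2)).const_mul 2
  rw [Real.sqrt_zero, mul_zero, mul_zero, add_zero, zero_div, mul_zero] at h1
  exact h1

/-- The part of the view that is common to both inputs carries no information beyond the outcome
of the coin toss. As the entropy is monotone in the weights, it bounds the entropy that remains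
given the view from below, and it has almost all the weight. -/
lemma excessInfo_le (hN : 2 ≤ N) {η : ℝ} (hη : η ∈ Set.Icc (0 : ℝ) 1) :
    S.excessInfo P η ≤ infoBound N := by
  obtain ⟨hη0, hη1⟩ := hη
  have hη1' : 0 ≤ 1 - η := sub_nonneg.2 hη1
  let H : Fin 2 → ℝ := fun c => weightedEntropy (η * P.prob 0 c) ((1 - η) * P.prob 1 c)
  let T : Fin 2 → ℝ := fun c => ∑' k, ∑ y, S.commonView P k c y
  have hT0 : ∀ c, 0 ≤ T c := fun c =>
    tsum_nonneg fun k => Finset.sum_nonneg fun y _ => S.commonView_nonneg P k c y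
  have hu0 : ∀ c, 0 ≤ η * P.prob 0 c := fun c => mul_nonneg hη0 (P.prob_pos 0 c).le
  have hu1 : ∀ c, 0 ≤ (1 - η) * P.prob 1 c := fun c => mul_nonneg hη1' (P.prob_pos 1 c).le
  have hule0 : ∀ c, η * P.prob 0 c ≤ η := fun c => mul_le_of_le_one_right hη0 (P.prob_le_one 0 c)
  have hule1 : ∀ c, (1 - η) * P.prob 1 c ≤ 1 - η := fun c =>
    mul_le_of_le_one_right hη1' (P.prob_le_one 1 c)
  -- the entropy given the outcome alone is hardly larger than that of the common part
  have hout : ∀ c, weightedEntropy (η * S.outProb P 0 c) ((1 - η) * S.outProb P 1 c) ≤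
      T c * H c + (4 * √(2 * deviation N) + 2 * (2 * deviation N)) / Real.log 2 := by
    intro c
    obtain ⟨hx0, hx0'⟩ := S.tsum_condView_sub_mem P hN 0 c
    obtain ⟨hx1, hx1'⟩ := S.tsum_condView_sub_mem P hN 1 c
    have hF0 := S.tsum_condView_le P hN 0 c
    have hF1 := S.tsum_condView_le P hN 1 c
    rw [outProb_eq, outProb_eq, ← mul_assoc, ← mul_assoc, ← weightedEntropy_mul (hT0 c)]
    set F0 := ∑' k, ∑ y, S.condView P 0 k c y
    set F1 := ∑' k, ∑ y, S.condView P 1 k c y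
    have e0 : η * P.prob 0 c * F0 = T c * (η * P.prob 0 c) + η * P.prob 0 c * (F0 - T c) := by ring
    have e1 : (1 - η) * P.prob 1 c * F1 =
        T c * ((1 - η) * P.prob 1 c) + (1 - η) * P.prob 1 c * (F1 - T c) := by ring
    have hmass : η * P.prob 0 c * F0 + (1 - η) * P.prob 1 c * F1 ≤ 1 := by
      have := mul_le_of_le_one_right (hu0 c) hF0
      have := mul_le_of_le_one_right (hu1 c) hF1
      linarith [hule0 c, hule1 c]
    rw [e0, e1] at hmass ⊢
    exact weightedEntropy_add_le (mul_nonneg (hT0 c) (hu0 c)) (mul_nonneg (hT0 c) (hu1 c))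
      (mul_nonneg (hu0 c) hx0) (mul_nonneg (hu1 c) hx1)
      ((mul_le_of_le_one_left hx0 ((hule0 c).trans hη1)).trans hx0')
      ((mul_le_of_le_one_left hx1 ((hule1 c).trans (sub_le_self 1 hη0))).trans hx1') hmass
  -- the entropy given Alice's view is at least that of the common part
  have hv0 : ∀ k c y, 0 ≤ η * S.viewProb P 0 k c y := fun k c y =>
    mul_nonneg hη0 (S.viewProb_nonneg P 0 k c y)
  have hv1 : ∀ k c y, 0 ≤ (1 - η) * S.viewProb P 1 k c y := fun k c y =>
    mul_nonneg hη1' (S.viewProb_nonneg P 1 k c y)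
  have hview : ∀ k, ∑ c, (∑ y, S.commonView P k c y) * H c ≤ ∑ c, ∑ y,
      weightedEntropy (η * S.viewProb P 0 k c y) ((1 - η) * S.viewProb P 1 k c y) := by
    intro k
    refine Finset.sum_le_sum fun c _ => ?_
    rw [Finset.sum_mul]
    refine Finset.sum_le_sum fun y _ => ?_
    have hm := S.commonView_nonneg P k c y
    rw [viewProb_eq, viewProb_eq, ← mul_assoc, ← mul_assoc, ← weightedEntropy_mul hm]
    refine weightedEntropy_mono (mul_nonneg hm (hu0 c)) (mul_nonneg hm (hu1 c)) ?_ ?_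
    · rw [mul_comm]; exact mul_le_mul_of_nonneg_left (S.commonView_le P 0 k c y) (hu0 c)
    · rw [mul_comm]; exact mul_le_mul_of_nonneg_left (S.commonView_le P 1 k c y) (hu1 c)
  have hsum : Summable fun k => ∑ c, ∑ y,
      weightedEntropy (η * S.viewProb P 0 k c y) ((1 - η) * S.viewProb P 1 k c y) := by
    refine summable_sum fun c _ => ?_
    refine Summable.of_nonneg_of_le (fun k => Finset.sum_nonneg fun y _ =>
      weightedEntropy_nonneg (hv0 k c y) (hv1 k c y)) (fun k => Finset.sum_le_sum fun y _ =>
      weightedEntropy_le (hv0 k c y) (hv1 k c y)) ?_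
    simp only [← Finset.sum_div, Finset.sum_add_distrib, ← Finset.mul_sum]
    exact (((S.summable_sum_viewProb P hN 0 c).mul_left η).add
      ((S.summable_sum_viewProb P hN 1 c).mul_left (1 - η))).div_const _
  have hcs : ∀ c ∈ Finset.univ, Summable fun k => (∑ y, S.commonView P k c y) * H c := fun c _ =>
    (S.summable_commonView P hN c).mul_right _
  have hlow := (summable_sum hcs).tsum_le_tsum hview hsum
  rw [Summable.tsum_finsetSum hcs] at hlow
  simp only [tsum_mul_right] at hlow
  have hup := Finset.sum_le_sum fun c (_ : c ∈ Finset.univ) => hout c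
  rw [Finset.sum_add_distrib] at hup
  simp only [Finset.sum_const, Finset.card_univ, Fintype.card_fin, nsmul_eq_mul,
    Nat.cast_ofNat] at hup
  rw [excessInfo, infoBound]
  have hT : ∑ c, T c * H c = ∑ c, (∑' k, ∑ y, S.commonView P k c y) * H c := rfl
  linarith

end AliceStrategy

end VBCT2

theorem mainTheorem2 :
    -- any range of biases
    (∀ p q : ℝ, 0 < p → p < q → q < 1 → ∃ P : VBCT2.Params, P.pmin = p ∧ P.pmax = q) ∧
    -- honest parties never abort and get the same output, with the bias of Bob's choice
    (∀ (P : VBCT2.Params) (N M : ℕ) (w cA cB : Fin 2), 2 ≤ N →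
      VBCT2.honestOut P N M w cA cB = if cA = cB then P.prob w cA else 0) ∧
    -- the states distinguishing Bob's inputs, and their optimal discrimination
    (∀ P : VBCT2.Params,
      Filter.Tendsto
        (fun N : ℕ => VBCT2.traceDist (P.sigma 0 (N - 1)) (P.sigma 1 (N - 1)))
        Filter.atTop (nhds 0) ∧
      Filter.Tendsto
        (fun N : ℕ => VBCT2.traceDist (P.rhoSigma N 0) (P.rhoSigma N 1))
        Filter.atTop (nhds (VBCT2.traceDist (P.rho 0) (P.rho 1))) ∧
      ∀ η ∈ Set.Icc (0 : ℝ) 1,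
        Filter.Tendsto (fun N : ℕ => sSup (VBCT2.successProbs η (P.rhoSigma N)))
          Filter.atTop (nhds (sSup (VBCT2.successProbs η P.rho))) ∧
        ∃ guess : Fin 2 → Fin 2,
          IsGreatest (VBCT2.successProbs η P.rho)
            (∑ c, VBCT2.prior η (guess c) * P.prob (guess c) c)) ∧
    -- Alice cannot affect the bias
    (∀ (P : VBCT2.Params) (N : ℕ) (S : VBCT2.AliceStrategy N) (w c : Fin 2), 2 ≤ N →
      S.outProb P w c ≤ P.prob w c) ∧
    -- Alice's undetected excess information tends to zero
    (∃ ε : ℕ → ℝ, Filter.Tendsto ε Filter.atTop (nhds 0) ∧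
      ∀ (P : VBCT2.Params) (N : ℕ) (S : VBCT2.AliceStrategy N), 2 ≤ N →
        ∀ η ∈ Set.Icc (0 : ℝ) 1, S.excessInfo P η ≤ ε N) ∧
    -- a Bob who cheats with non-negligible probability is almost certainly caught
    (∀ δ δ' κ : ℝ, 0 < δ → 0 < δ' → 0 < κ → ∃ M₀ : ℕ, ∀ M ≥ M₀,
      ∀ (P : VBCT2.Params) (N : ℕ) (S : VBCT2.BobStrategy N) (c : Fin 2),
        δ' * S.tossProb P M ≤ S.cheatProb P M c δ → 1 - κ ≤ S.caughtProb P M) ∧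
    -- Bob cannot bring the outcome probabilities outside the permitted range
    (∃ ε : ℕ → ℝ, Filter.Tendsto ε Filter.atTop (nhds 0) ∧
      ∀ (P : VBCT2.Params) (N M : ℕ) (S : VBCT2.BobStrategy N),
        ∃ p ∈ Set.Icc P.pmin P.pmax,
          S.outProb P M 0 ≤ p + ε M ∧ S.outProb P M 1 ≤ 1 - p + ε M) := by
  refine ⟨fun p q hp hpq hq => VBCT2.exists_params hp hpq hq,
    fun P N M w cA cB hN => VBCT2.honestOut_eq P hN M w cA cB,
    fun P => ⟨P.tendsto_traceDist_sigma, P.tendsto_traceDist_rhoSigma,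
      fun η _ => ⟨P.tendsto_sSup_successProbs η, P.exists_guess η⟩⟩,
    fun P N S w c hN => S.outProb_le P hN w c,
    ⟨VBCT2.AliceStrategy.infoBound, VBCT2.AliceStrategy.tendsto_infoBound,
      fun P N S hN η hη => S.excessInfo_le P hN hη⟩,
    fun δ δ' κ hδ hδ' hκ => VBCT2.exists_caughtProb_ge hδ hδ' hκ,
    ⟨_, VBCT2.tendsto_bob_error, fun P N M S => VBCT2.exists_outProb_le P N M S⟩⟩
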